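/- Let $c>0$ be a constant. A clause over the variables $x_1,\dots,x_n$ is a set of literals, read as a disjunction; it is a Horn clause if it contains at most one positive literal (a variable may occur in it both positively and negatively, so there are $(n+1)2^n-1$ nonempty Horn clauses). Let $\Phi\in\Omega(n,\lfloor c\,2^n\rfloor)$ be a random formula consisting of $\lfloor c\,2^n\rfloor$ clauses chosen independently and uniformly at random, with repetition, from all nonempty Horn clauses over $x_1,\dots,x_n$. The algorithm PUR works as follows on a formula. If it contains no positive unit clause, PUR returns TRUE. Otherwise it chooses uniformly at random an occurrence of a positive unit clause $x$; if the formula contains the clause $\overline{x}$, PUR returns FALSE; otherwise $x$ is set to $1$ (clauses containing $x$ are removed, $\overline{x}$ is deleted from the remaining clauses) and PUR is called recursively on the resulting formula. Let $Y_n$ be the number of iterations of PUR on $\Phi$, i.e. the number of variables set to $1$ (recursive calls) before it halts. For an integer $k$, possibly a function of $n$, let $\eta_{n,k}$ be the probability that $Y_n=\lfloor\log_2 n\rfloor+k$, conditional on $\Phi$ being unsatisfiable. Then: 1. For every integer sequence $(k_n)$ with $\lim_{n\to\infty}|k_n-\log_2 n|=\infty$, $\lim_{n\to\infty}\Pr[\,Y_n=k_n\mid\Phi\text{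 is unsatisfiable}\,]=0$. (Equivalently, $\eta_{n,k_n}\to0$ whenever $|k_n|\to\infty$.) 2. For every fixed $k\in\mathbb Z$, as $n\to\infty$, $$\eta_{n,k}=G(k-1,c_n)-G(k,c_n)+o(1),\qquad G(k,c)=\exp\Bigl(-c\sum_{j=-\infty}^{k}2^j\Bigr),\qquad c_n=\frac{c}{2^{\{\log_2 n\}}},$$ where $\{\cdot\}$ denotes the fractional part. -/

import Mathlib

open Filter Topology Asymptotics

noncomputable section

namespace RandomHorn

/-- A literal over the variables `x_0, …, x_{n-1}`: `(x, true)` is the positive literal `x`,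
`(x, false)` is the negative literal `¬x`. -/
abbrev Literal (n : ℕ) := Fin n × Bool

/-- A clause is a finite set of literals, read as their disjunction. -/
abbrev Clause (n : ℕ) := Finset (Literal n)

/-- A formula is a finite list of clauses (repetitions allowed), read as their conjunction. -/
abbrev Formula (n : ℕ) := List (Clause n)

/-- A clause is Horn if it has at most one positive literal. -/
def Clause.IsHorn {n : ℕ} (C : Clause n) : Prop :=
  (C.filter fun l => l.2 = true).card ≤ 1

/-- The nonempty Horn clauses over `n` variables. -/
abbrev HornClause (n : ℕ) := {C : Clause n // C.Nonempty ∧ C.IsHorn}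

/-- `v` satisfies `Φ` if every clause of `Φ` has a literal which is true under `v`. -/
def Formula.SatisfiedBy {n : ℕ} (Φ : Formula n) (v : Fin n → Bool) : Prop :=
  ∀ C ∈ Φ, ∃ l ∈ C, v l.1 = l.2

def Formula.Satisfiable {n : ℕ} (Φ : Formula n) : Prop :=
  ∃ v : Fin n → Bool, Φ.SatisfiedBy v

/-- The formula obtained by setting `x` to `1`: clauses containing the literal `x` disappear,
and the literal `¬x` is deleted from the other ones. -/
def setTrue {n : ℕ} (x : Fin n) (Φ : Formula n) : Formula n :=
  (Φ.filter fun C => (x, true) ∉ C).map fun C => C.erase (x, false)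

/-- The occurrences of positive unit clauses in `Φ`: pairs of a position in `Φ` and a
variable `x` such that the clause at that position is the unit clause `x`. -/
abbrev PosUnit {n : ℕ} (Φ : Formula n) :=
  {p : Fin Φ.length × Fin n // Φ.get p.1 = {(p.2, true)}}

theorem setTrue_length_lt {n : ℕ} (Φ : Formula n) (p : PosUnit Φ) :
    (setTrue p.1.2 Φ).length < Φ.length := by
  unfold setTrue
  rw [List.length_map]
  have hmem : Φ.get p.1.1 ∈ Φ := List.get_mem _ _
  have hp := p.2
  refine List.length_filter_lt_length_iff_exists.2 ⟨_, hmem, ?_⟩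
  rw [hp]
  simp

open scoped Classical in
/-- The randomized procedure PUR (positive unit resolution). The result is the law of the pair
consisting of the answer (`true` = accept, `false` = reject) and of the number of iterations,
i.e. of the number of variables that were set to `1` (recursive calls) before halting. -/
def PUR {n : ℕ} (Φ : Formula n) : PMF (Bool × ℕ) :=
  if h : Nonempty (PosUnit Φ) then
    (PMF.uniformOfFintype (PosUnit Φ)).bind fun p =>
      if ({(p.1.2, false)} : Clause n) ∈ Φ then
        PMF.pure (false, 0)
      else
        (PUR (setTrue p.1.2 Φ)).map fun r => (r.1, r.2 + 1)
  else
    PMF.pure (true, 0)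
termination_by Φ.length
decreasing_by exact setTrue_length_lt Φ p

instance instNonemptyHornClause (n : ℕ) [NeZero n] : Nonempty (HornClause n) :=
  ⟨⟨{((0 : Fin n), true)}, by simp,
    (Finset.card_filter_le _ _).trans (Finset.card_singleton _).le⟩⟩

open scoped Classical in
/-- The random formula `Ω(n, m)`: `m` clauses chosen independently and uniformly, with
repetition, from all nonempty Horn clauses over `n` variables. -/
def randomFormula (n m : ℕ) [NeZero n] : PMF (Formula n) :=
  (PMF.uniformOfFintype (Fin m → HornClause n)).map fun f => List.ofFn fun i => (f i : Clause n)

/-- The joint law of a random formula `Φ ∈ Ω(n, m)` and of the number of iterations of PUR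
on `Φ`. -/
def runLaw (n m : ℕ) [NeZero n] : PMF (Formula n × ℕ) :=
  (randomFormula n m).bind fun Φ => (PUR Φ).map fun r => (Φ, r.2)

/-- The probability of the event `A` under `p`. -/
def prob {α : Type*} (p : PMF α) (A : Set α) : ℝ := (p.toOuterMeasure A).toReal

/-- The probability of `A` under `p`, conditional on `B`. -/
def condProb {α : Type*} (p : PMF α) (A B : Set α) : ℝ := prob p (A ∩ B) / prob p B

/-- The probability that PUR runs exactly `i` iterations on a random `Φ ∈ Ω(n, ⌊c 2^n⌋)`,
conditional on `Φ` being unsatisfiable (with the value `0` for `n = 0`, where there is no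
nonempty clause). -/
def iterProbUnsat (c : ℝ) (n : ℕ) (i : ℤ) : ℝ :=
  if h : n = 0 then 0
  else
    haveI : NeZero n := ⟨h⟩
    condProb (runLaw n ⌊c * 2 ^ n⌋₊) {ω | (ω.2 : ℤ) = i} {ω | ¬ ω.1.Satisfiable}

/-- `η_{n,k}`: the conditional probability of `⌊log₂ n⌋ + k` iterations. -/
def eta (c : ℝ) (n : ℕ) (k : ℤ) : ℝ := iterProbUnsat c n (⌊Real.logb 2 n⌋ + k)

/-- `G(k, c) = exp (-c ∑_{j ≤ k} 2^j)`, the sum being over all integers `j ≤ k`. -/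
def G (k : ℤ) (c : ℝ) : ℝ := Real.exp (-c * ∑' j : Set.Iic k, (2 : ℝ) ^ (j : ℤ))

/-- `c_n = c / 2^{log₂ n}`, with the fractional part of `log₂ n` as exponent. -/
def cSeq (c : ℝ) (n : ℕ) : ℝ := c / 2 ^ Int.fract (Real.logb 2 n)

end RandomHorn

end

/-! Ignore rejections and let unit propagation run on. Which variables it sets, and in which order,
depends only on the clauses with a positive literal (`chainProb_filter_hasPos`). Along a chain of
set variables, PUR has survived exactly if no clause consists solely of negations of those variables
(`survives_iff`). Given the clauses with a positive literal and the positions of the purely negative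
ones, the latter are independent and uniform among all `2^n - 1`. Hence survival along a chain of
`i` distinct variables has a conditional probability `negWeight i` that depends only on `i` and on
the number of purely negative clauses. So the probability of rejecting after `i` iterations is the
mean of `reach (i+1) * (negWeight i - negWeight (i+1))` (`avg_PUR_false`).

Two facts evaluate this mean. First, when `2^i = O(n)`, `negWeight i` has exponentially small
variance (`variance_negWeight_le`), and its mean `avoidProb` is asymptotic to `exp (-c * 2^i / n)`
(`tendsto_avoidProb_sub_exp`). The mean of the product therefore factorizes up to `o(1)`
(`abs_rejectProb_sub_le`). Second, a first moment bound shows that propagation stops after exactly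
`i ≤ n/2` steps with probability at most `stopBound c i`, which is summable (`avg_reach_sub_le`).
Thus propagation stops after few steps or is unlikely to stop before step `n/2`, by which time
rejection is almost certain. It follows that `reachProb` and `unsatProb` agree asymptotically along
every index tending to infinity below `n/2` (`tendsto_reachProb_sub_unsatProb`).

Dividing leaves `avoidProb i - avoidProb (i+1)`. At `i = ⌊log₂ n⌋ + k` this is the difference of the
two values of `G`, by `G_eq`. The division is legitimate because `unsatProb` is bounded below
(`exists_eventually_le_unsatProb`): with positive probability there are so many unit clauses that
the tail of `stopBound` is smaller. The first claim needs only this lower bound and the crude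
estimates by `avoidProb i` and `1 - avoidProb (i+1)` (`rejectProb_le`). -/

noncomputable section

namespace RandomHorn

open scoped Classical

/-! ### PUR and unit propagation on a fixed formula. -/

section

variable {n : ℕ}

/-- The number of occurrences of the positive unit clause `x`. -/
def unitWeight (Φ : Formula n) (x : Fin n) : ℕ := Φ.count {(x, true)}

def totalWeight (Φ : Formula n) : ℕ := ∑ x, unitWeight Φ x

/-- The probability that PUR picks the variable `x` in its next step. -/
def stepProb (Φ : Formula n) (x : Fin n) : ℝ := unitWeight Φ x / totalWeight Φ

/-- The probability that unit propagation, disregarding rejections, starts by setting the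
variables of the list in the given order. -/
def chainProb : Formula n → List (Fin n) → ℝ
  | _, [] => 1
  | Φ, x :: xs => stepProb Φ x * chainProb (setTrue x Φ) xs

/-- PUR does not reject while the variables of the list are set in the given order. -/
def Survives : Formula n → List (Fin n) → Prop
  | _, [] => True
  | Φ, x :: xs => ({(x, false)} : Clause n) ∉ Φ ∧ Survives (setTrue x Φ) xs

/-- The clause consisting of the negations of the variables in `S`. -/
def negClause (S : Finset (Fin n)) : Clause n := S.image fun x => (x, false)

/-- The probability that unit propagation, disregarding rejections, makes at least `i` steps. -/
def reach (Φ : Formula n) (i : ℕ) : ℝ := ∑ v : Fin i → Fin n, chainProb Φ (List.ofFn v)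

theorem mem_setTrue {x : Fin n} {Φ : Formula n} {D : Clause n} :
    D ∈ setTrue x Φ ↔ ∃ C ∈ Φ, (x, true) ∉ C ∧ C.erase (x, false) = D := by
  simp [setTrue, and_assoc]

theorem mem_negClause {S : Finset (Fin n)} {l : Literal n} :
    l ∈ negClause S ↔ l.1 ∈ S ∧ l.2 = false := by
  rcases l with ⟨x, b⟩
  simp only [negClause, Finset.mem_image, Prod.mk.injEq]
  constructor
  · rintro ⟨y, hy, rfl, rfl⟩
    exact ⟨hy, rfl⟩
  · rintro ⟨h, rfl⟩
    exact ⟨x, h, rfl, rfl⟩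

theorem unitWeight_pos {Φ : Formula n} {x : Fin n} :
    0 < unitWeight Φ x ↔ ({(x, true)} : Clause n) ∈ Φ := by
  simp [unitWeight, List.count_pos_iff]

theorem sum_cons {i : ℕ} {α : Type*} [Fintype α] (F : (Fin (i + 1) → α) → ℝ) :
    ∑ v, F v = ∑ x, ∑ v : Fin i → α, F (Fin.cons x v) := by
  rw [← Fintype.sum_prod_type']
  exact (Fintype.sum_equiv (Fin.consEquiv fun _ => α) _ _ fun _ => rfl).symm

theorem card_get_eq {α : Type*} [DecidableEq α] (l : List α) (a : α) :
    (Finset.univ.filter fun t : Fin l.length => l.get t = a).card = l.count a := by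
  induction l with
  | nil => simp
  | cons b l ih =>
    rw [List.count_cons, ← ih]
    simp only [List.get_eq_getElem, Finset.card_filter, beq_iff_eq]
    have h := Fin.sum_univ_succ (n := l.length)
      (fun t : Fin (l.length + 1) => if (b :: l)[(t : ℕ)] = a then 1 else 0)
    simp only [Fin.val_zero, List.getElem_cons_zero, Fin.val_succ, List.getElem_cons_succ] at h
    exact h.trans (add_comm _ _)

/-- Turns the uniform choice of an occurrence into a choice of a variable weighted by its
multiplicity. -/
theorem sum_posUnit (Φ : Formula n) (F : Fin n → ℝ) :
    ∑ p : PosUnit Φ, F p.1.2 = ∑ x, (unitWeight Φ x : ℝ) * F x := by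
  rw [← Finset.sum_subtype (Finset.univ.filter fun p : Fin Φ.length × Fin n =>
    Φ.get p.1 = {(p.2, true)}) (by simp) (fun p => F p.2), Finset.sum_filter,
    Fintype.sum_prod_type_right]
  refine Finset.sum_congr rfl fun x _ => ?_
  rw [← Finset.sum_filter]
  change ∑ t with Φ.get t = {(x, true)}, F x = _
  rw [Finset.sum_const, nsmul_eq_mul, unitWeight, card_get_eq]

theorem card_posUnit (Φ : Formula n) : Fintype.card (PosUnit Φ) = totalWeight Φ := by
  have h := sum_posUnit Φ fun _ => 1
  simp only [Finset.sum_const, Finset.card_univ, nsmul_eq_mul, mul_one] at h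
  rw [totalWeight]
  exact_mod_cast h

theorem stepProb_nonneg (Φ : Formula n) (x : Fin n) : 0 ≤ stepProb Φ x := by
  unfold stepProb; positivity

theorem sum_stepProb (Φ : Formula n) :
    ∑ x, stepProb Φ x = if totalWeight Φ = 0 then 0 else 1 := by
  simp only [stepProb, ← Finset.sum_div]
  rw [← Nat.cast_sum, ← totalWeight]
  split_ifs with h
  · simp [h]
  · exact div_self (by exact_mod_cast h)

theorem PUR_false_zero (Φ : Formula n) :
    (PUR Φ (false, 0)).toReal =
      ∑ x, stepProb Φ x * if ({(x, false)} : Clause n) ∈ Φ then 1 else 0 := by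
  rw [PUR]
  split_ifs with h
  · rw [PMF.bind_apply, tsum_fintype, ENNReal.toReal_sum (fun p _ => ?_)]
    · have h1 := sum_posUnit Φ fun x => ((totalWeight Φ : ℝ))⁻¹ *
        if ({(x, false)} : Clause n) ∈ Φ then 1 else 0
      calc _ = _ := Finset.sum_congr rfl fun p _ => ?_
        _ = _ := h1
        _ = _ := Finset.sum_congr rfl fun x _ => by rw [stepProb]; ring
      rw [ENNReal.toReal_mul, PMF.uniformOfFintype_apply, card_posUnit]
      congr 1
      · simp
      · split_ifs
        · simp
        · rw [PMF.map_apply]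
          simp [Prod.ext_iff]
    · exact ENNReal.mul_ne_top (PMF.apply_ne_top _ _) (PMF.apply_ne_top _ _)
  · have h0 : totalWeight Φ = 0 := by
      rw [← card_posUnit, Fintype.card_eq_zero_iff]; exact not_nonempty_iff.1 h
    simp [stepProb, h0]

theorem PUR_false_succ (Φ : Formula n) (i : ℕ) :
    (PUR Φ (false, i + 1)).toReal =
      ∑ x, stepProb Φ x * if ({(x, false)} : Clause n) ∈ Φ then 0 else
        (PUR (setTrue x Φ) (false, i)).toReal := by
  rw [PUR]
  split_ifs with h
  · rw [PMF.bind_apply, tsum_fintype, ENNReal.toReal_sum (fun p _ => ?_)]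
    · have h1 := sum_posUnit Φ fun x => ((totalWeight Φ : ℝ))⁻¹ *
        if ({(x, false)} : Clause n) ∈ Φ then 0 else (PUR (setTrue x Φ) (false, i)).toReal
      calc _ = _ := Finset.sum_congr rfl fun p _ => ?_
        _ = _ := h1
        _ = _ := Finset.sum_congr rfl fun x _ => by rw [stepProb]; ring
      rw [ENNReal.toReal_mul, PMF.uniformOfFintype_apply, card_posUnit]
      congr 1
      · simp
      · split_ifs
        · simp
        · rw [PMF.map_apply, tsum_eq_single (false, i)]
          · simp
          · rintro ⟨b, j⟩ hb
            have : ¬ ((false, i + 1) = (b, j + 1)) := by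
              rintro h; apply hb; simp at h; simp [h]
            simp only [this, if_false]
    · exact ENNReal.mul_ne_top (PMF.apply_ne_top _ _) (PMF.apply_ne_top _ _)
  · have h0 : totalWeight Φ = 0 := by
      rw [← card_posUnit, Fintype.card_eq_zero_iff]; exact not_nonempty_iff.1 h
    simp [stepProb, h0]

/-- A run rejecting after `i` iterations picks `i + 1` variables: the last one is picked but never
set, because its negation is a unit clause. The difference of indicators selects survival of the
first `i` choices and failure at the last. -/
theorem PUR_false_eq_sum (Φ : Formula n) (i : ℕ) :
    (PUR Φ (false, i)).toReal = ∑ v : Fin (i + 1) → Fin n, chainProb Φ (List.ofFn v) *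
      ((if Survives Φ ((List.ofFn v).take i) then 1 else 0) -
        if Survives Φ (List.ofFn v) then 1 else 0) := by
  induction i generalizing Φ with
  | zero =>
    rw [PUR_false_zero, sum_cons]
    refine Finset.sum_congr rfl fun x _ => ?_
    simp [chainProb, Survives]
    split_ifs <;> simp
  | succ i ih =>
    rw [PUR_false_succ, sum_cons]
    refine Finset.sum_congr rfl fun x _ => ?_
    simp only [List.ofFn_cons, List.take_succ_cons, chainProb, Survives, mul_assoc,
      ← Finset.mul_sum]
    congr 1
    by_cases hx : ({(x, false)} : Clause n) ∈ Φ
    · simp [hx]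
    · simp [hx, ih]

theorem not_empty_mem_setTrue {Φ : Formula n} {x : Fin n} (h : (∅ : Clause n) ∉ Φ)
    (hx : ({(x, false)} : Clause n) ∉ Φ) : (∅ : Clause n) ∉ setTrue x Φ := by
  rw [mem_setTrue]
  rintro ⟨C, hC, -, hD⟩
  rcases (Finset.erase_eq_empty_iff C (x, false)).1 hD with rfl | rfl
  · exact h hC
  · exact hx hC

/-- A rejection means that all but one literal of some clause were deleted and the remaining one is
the negation of the chosen variable. Only the set of chosen variables matters, not their order. -/
theorem survives_iff {Φ : Formula n} (h : (∅ : Clause n) ∉ Φ) (xs : List (Fin n)) :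
    Survives Φ xs ↔ ∀ C ∈ Φ, ¬ C ⊆ negClause xs.toFinset := by
  induction xs generalizing Φ with
  | nil =>
    simp only [Survives, true_iff]
    intro C hC hs
    have : C = ∅ := by simpa [negClause] using hs
    exact h (this ▸ hC)
  | cons x xs ih =>
    rw [Survives]
    constructor
    · rintro ⟨hx, hs⟩ C hC hsub
      rw [ih (not_empty_mem_setTrue h hx)] at hs
      refine hs (C.erase (x, false)) (mem_setTrue.2 ⟨C, hC, fun hx' => ?_, rfl⟩) fun l hl => ?_
      · simpa using (mem_negClause.1 (hsub hx')).2
      · rw [Finset.mem_erase] at hl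
        have := mem_negClause.1 (hsub hl.2)
        simp only [List.toFinset_cons, Finset.mem_insert] at this
        refine mem_negClause.2 ⟨this.1.resolve_left fun h1 => hl.1 (Prod.ext h1 this.2), this.2⟩
    · intro hs
      have hx : ({(x, false)} : Clause n) ∉ Φ := fun hx =>
        hs _ hx (by simp [mem_negClause])
      refine ⟨hx, (ih (not_empty_mem_setTrue h hx)).2 fun D hD hsub => ?_⟩
      obtain ⟨C, hC, hxC, rfl⟩ := mem_setTrue.1 hD
      refine hs C hC fun l hl => mem_negClause.2 ?_
      by_cases hlx : l = (x, false)
      · subst hlx; simp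
      · have := mem_negClause.1 (hsub (Finset.mem_erase.2 ⟨hlx, hl⟩))
        simp only [List.toFinset_cons, Finset.mem_insert]
        exact ⟨Or.inr this.1, this.2⟩

theorem satisfiable_setTrue_iff {Φ : Formula n} {x : Fin n} (hx : ({(x, true)} : Clause n) ∈ Φ) :
    (setTrue x Φ).Satisfiable ↔ Φ.Satisfiable := by
  constructor
  · rintro ⟨v, hv⟩
    refine ⟨Function.update v x true, fun C hC => ?_⟩
    by_cases h : (x, true) ∈ C
    · exact ⟨_, h, by simp⟩
    · obtain ⟨l, hl, hvl⟩ := hv _ (mem_setTrue.2 ⟨C, hC, h, rfl⟩)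
      rw [Finset.mem_erase] at hl
      refine ⟨l, hl.2, ?_⟩
      have : l.1 ≠ x := by
        rintro rfl
        rcases l with ⟨y, b⟩
        cases b
        · exact hl.1 rfl
        · exact h hl.2
      rw [Function.update_of_ne this, hvl]
  · rintro ⟨v, hv⟩
    have hvx : v x = true := by
      obtain ⟨l, hl, h⟩ := hv _ hx
      rw [Finset.mem_singleton] at hl
      subst hl; exact h
    refine ⟨v, fun D hD => ?_⟩
    obtain ⟨C, hC, hxC, rfl⟩ := mem_setTrue.1 hD
    obtain ⟨l, hl, h⟩ := hv C hC
    refine ⟨l, Finset.mem_erase.2 ⟨?_, hl⟩, h⟩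
    rintro rfl
    simp [hvx] at h

theorem IsHorn.mono {C D : Clause n} (h : D ⊆ C) (hC : C.IsHorn) : D.IsHorn :=
  (Finset.card_le_card (Finset.filter_subset_filter _ h)).trans hC

theorem satisfiable_of_isEmpty_posUnit {Φ : Formula n} (h : (∅ : Clause n) ∉ Φ)
    (hH : ∀ C ∈ Φ, C.IsHorn) (hu : ¬ Nonempty (PosUnit Φ)) : Φ.Satisfiable := by
  refine ⟨fun _ => false, fun C hC => ?_⟩
  by_contra! hcon
  have hall : ∀ l ∈ C, l.2 = true := fun l hl => by
    have := hcon l hl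
    cases hb : l.2 <;> simp_all
  have hcard := hH C hC
  rw [Clause.IsHorn, Finset.filter_true_of_mem hall] at hcard
  have hne : C.Nonempty := Finset.nonempty_iff_ne_empty.2 fun h' => h (h' ▸ hC)
  obtain ⟨l, hl⟩ := Finset.card_eq_one.1 (le_antisymm hcard hne.card_pos)
  obtain ⟨t, ht⟩ := List.get_of_mem hC
  refine hu ⟨⟨(t, l.1), ?_⟩⟩
  have := hall l (by simp [hl])
  show Φ.get t = {(l.1, true)}
  rw [ht, hl, ← this]

/-- Setting a forced variable preserves satisfiability, and a Horn formula without positive unit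
clauses and without the empty clause is satisfied by the all-false assignment. This identifies
unsatisfiability with rejection. -/
theorem PUR_answer {Φ : Formula n} (h : (∅ : Clause n) ∉ Φ) (hH : ∀ C ∈ Φ, C.IsHorn)
    {r : Bool × ℕ} (hr : r ∈ (PUR Φ).support) : r.1 = true ↔ Φ.Satisfiable := by
  induction hL : Φ.length using Nat.strong_induction_on generalizing Φ r with
  | _ L ih =>
  rw [PUR] at hr
  split_ifs at hr with hne
  · simp only [PMF.mem_support_bind_iff] at hr
    obtain ⟨p, -, hp⟩ := hr
    have hmem : ({(p.1.2, true)} : Clause n) ∈ Φ := p.2 ▸ List.get_mem _ _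
    split_ifs at hp with hf
    · simp only [PMF.support_pure, Set.mem_singleton_iff] at hp
      subst hp
      simp only [Bool.false_eq_true, false_iff]
      rintro ⟨v, hv⟩
      obtain ⟨l, hl, h1⟩ := hv _ hf
      obtain ⟨l', hl', h2⟩ := hv _ hmem
      rw [Finset.mem_singleton] at hl hl'
      subst hl hl'
      simp_all
    · simp only [PMF.support_map, Set.mem_image] at hp
      obtain ⟨r', hr', rfl⟩ := hp
      rw [← satisfiable_setTrue_iff hmem]
      change r'.1 = true ↔ _
      refine ih _ (hL ▸ setTrue_length_lt Φ p) (not_empty_mem_setTrue h hf) ?_ hr' rfl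
      intro D hD
      obtain ⟨C, hC, -, rfl⟩ := mem_setTrue.1 hD
      exact IsHorn.mono (Finset.erase_subset _ _) (hH C hC)
  · simp only [PMF.support_pure, Set.mem_singleton_iff] at hr
    subst hr
    simp [satisfiable_of_isEmpty_posUnit h hH hne]

theorem chainProb_nonneg (Φ : Formula n) (xs : List (Fin n)) : 0 ≤ chainProb Φ xs := by
  induction xs generalizing Φ with
  | nil => simp [chainProb]
  | cons x xs ih => exact mul_nonneg (stepProb_nonneg _ _) (ih _)

theorem mem_of_stepProb_ne_zero {Φ : Formula n} {x : Fin n} (h : stepProb Φ x ≠ 0) :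
    ({(x, true)} : Clause n) ∈ Φ := by
  rw [← unitWeight_pos, Nat.pos_iff_ne_zero]
  rintro h0
  simp [stepProb, h0] at h

/-- The witness is the original clause that has shrunk to the unit clause used at step `j`. These
witnesses are counted in the first moment bound. -/
theorem exists_clause_of_chainProb_ne_zero {Φ : Formula n} {xs : List (Fin n)}
    (h : chainProb Φ xs ≠ 0) (j : ℕ) (hj : j < xs.length) :
    ∃ C ∈ Φ, (xs[j], true) ∈ C ∧
      C ⊆ insert (xs[j], true) (negClause (xs.take j).toFinset) := by
  induction xs generalizing Φ j with
  | nil => simp at hj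
  | cons x xs ih =>
    simp only [chainProb, ne_eq, mul_eq_zero, not_or] at h
    cases j with
    | zero => exact ⟨_, mem_of_stepProb_ne_zero h.1, by simp⟩
    | succ j =>
      obtain ⟨D, hD, h1, h2⟩ := ih h.2 j (by simpa using hj)
      obtain ⟨C, hC, hx, rfl⟩ := mem_setTrue.1 hD
      refine ⟨C, hC, Finset.mem_of_mem_erase h1, fun l hl => ?_⟩
      by_cases hlx : l = (x, false)
      · subst hlx; simp [mem_negClause]
      · have := h2 (Finset.mem_erase.2 ⟨hlx, hl⟩)
        simp only [Finset.mem_insert, mem_negClause, List.getElem_cons_succ,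
          List.take_succ_cons, List.toFinset_cons] at this ⊢
        tauto

theorem nodup_of_chainProb_ne_zero {Φ : Formula n} {xs : List (Fin n)}
    (h : chainProb Φ xs ≠ 0) : xs.Nodup := by
  induction xs generalizing Φ with
  | nil => simp
  | cons x xs ih =>
    simp only [chainProb, ne_eq, mul_eq_zero, not_or] at h
    refine List.nodup_cons.2 ⟨fun hx => ?_, ih h.2⟩
    obtain ⟨j, hj, rfl⟩ := List.getElem_of_mem hx
    obtain ⟨D, hD, h1, -⟩ := exists_clause_of_chainProb_ne_zero h.2 j hj
    obtain ⟨C, hC, hx, rfl⟩ := mem_setTrue.1 hD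
    exact hx (Finset.mem_of_mem_erase h1)

/-- Used in contrapositive form: once propagation has stopped, no clause of this shape can have been
in the formula. -/
theorem mem_foldl_setTrue {Φ : Formula n} {C : Clause n} (hC : C ∈ Φ) {x : Fin n}
    {xs : List (Fin n)} (hx : x ∉ xs) (hxC : (x, true) ∈ C)
    (hsub : C ⊆ insert (x, true) (negClause xs.toFinset)) :
    ({(x, true)} : Clause n) ∈ xs.foldl (fun Φ y => setTrue y Φ) Φ := by
  induction xs generalizing Φ C with
  | nil =>
    have : C = {(x, true)} := by
      refine Finset.Subset.antisymm ?_ (by simpa using hxC)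
      simpa [negClause] using hsub
    simpa [← this] using hC
  | cons y ys ih =>
    simp only [List.mem_cons, not_or] at hx
    refine ih (C := C.erase (y, false)) (mem_setTrue.2 ⟨C, hC, fun hy => ?_, rfl⟩) hx.2
      (by simp [hxC]) fun l hl => ?_
    · have := hsub hy
      simp only [Finset.mem_insert, mem_negClause, Prod.mk.injEq] at this
      rcases this with h | h
      · exact hx.1 h.1.symm
      · simp at h
    · rw [Finset.mem_erase] at hl
      have := hsub hl.2
      simp only [Finset.mem_insert, mem_negClause, List.toFinset_cons] at this ⊢
      rcases this with h | ⟨h | h, h'⟩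
      · exact Or.inl h
      · exact absurd (Prod.ext h h') hl.1
      · exact Or.inr ⟨h, h'⟩

theorem reach_zero (Φ : Formula n) : reach Φ 0 = 1 := by simp [reach, chainProb]

theorem reach_succ (Φ : Formula n) (i : ℕ) :
    reach Φ (i + 1) = ∑ x, stepProb Φ x * reach (setTrue x Φ) i := by
  rw [reach, sum_cons]
  simp [chainProb, reach, Finset.mul_sum]

/-- Here the last step is split off instead of the first: its probabilities sum to 1, or to 0 if no
unit clause is left. -/
theorem reach_succ_eq_sum (Φ : Formula n) (i : ℕ) :
    reach Φ (i + 1) = ∑ v : Fin i → Fin n, chainProb Φ (List.ofFn v) *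
      if totalWeight ((List.ofFn v).foldl (fun Φ y => setTrue y Φ) Φ) = 0 then 0 else 1 := by
  induction i generalizing Φ with
  | zero => simp [reach_succ, reach_zero, sum_stepProb, chainProb]
  | succ i ih =>
    rw [reach_succ, sum_cons]
    refine Finset.sum_congr rfl fun x _ => ?_
    rw [ih, Finset.mul_sum]
    simp [chainProb]

theorem reach_sub_reach_succ (Φ : Formula n) (i : ℕ) :
    reach Φ i - reach Φ (i + 1) = ∑ v : Fin i → Fin n, chainProb Φ (List.ofFn v) *
      if totalWeight ((List.ofFn v).foldl (fun Φ y => setTrue y Φ) Φ) = 0 then 1 else 0 := by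
  rw [reach_succ_eq_sum, reach, ← Finset.sum_sub_distrib]
  refine Finset.sum_congr rfl fun v _ => ?_
  split_ifs <;> ring

theorem reach_nonneg (Φ : Formula n) (i : ℕ) : 0 ≤ reach Φ i :=
  Finset.sum_nonneg fun _ _ => chainProb_nonneg _ _

theorem reach_antitone (Φ : Formula n) : Antitone (reach Φ) := by
  refine antitone_nat_of_succ_le fun i => sub_nonneg.1 ?_
  rw [reach_sub_reach_succ]
  exact Finset.sum_nonneg fun v _ => mul_nonneg (chainProb_nonneg _ _) (by split_ifs <;> simp)

theorem reach_le_one (Φ : Formula n) (i : ℕ) : reach Φ i ≤ 1 :=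
  (reach_antitone Φ (Nat.zero_le i)).trans_eq (reach_zero Φ)

theorem chainProb_le_one (Φ : Formula n) (xs : List (Fin n)) : chainProb Φ xs ≤ 1 := by
  have h1 := reach_le_one Φ xs.length
  rw [reach] at h1
  refine le_trans ?_ h1
  have := Finset.single_le_sum (f := fun v : Fin xs.length → Fin n => chainProb Φ (List.ofFn v))
    (fun v _ => chainProb_nonneg Φ _) (Finset.mem_univ xs.get)
  simpa using this

theorem reach_eq_one {Φ : Formula n} {i : ℕ}
    (h : i ≤ (Finset.univ.filter fun x => ({(x, true)} : Clause n) ∈ Φ).card) :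
    reach Φ i = 1 := by
  induction i generalizing Φ with
  | zero => exact reach_zero Φ
  | succ i ih =>
    have key : ∀ x, stepProb Φ x * reach (setTrue x Φ) i = stepProb Φ x := fun x => by
      rw [ih, mul_one]
      have h2 : (Finset.univ.filter fun y => ({(y, true)} : Clause n) ∈ Φ).erase x ⊆
          Finset.univ.filter fun y => ({(y, true)} : Clause n) ∈ setTrue x Φ := by
        intro y hy
        simp only [Finset.mem_erase, Finset.mem_filter, Finset.mem_univ, true_and] at hy ⊢
        refine mem_setTrue.2 ⟨_, hy.2, ?_, ?_⟩
        · simpa using fun h => hy.1 h.symm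
        · exact Finset.erase_eq_of_notMem (by simp)
      have h3 := Finset.card_le_card h2
      have h4 := Finset.pred_card_le_card_erase
        (s := Finset.univ.filter fun y => ({(y, true)} : Clause n) ∈ Φ) (a := x)
      omega
    rw [reach_succ, Finset.sum_congr rfl fun x _ => key x, sum_stepProb, if_neg]
    have hpos : 0 < (Finset.univ.filter fun x => ({(x, true)} : Clause n) ∈ Φ).card := by omega
    obtain ⟨x, hx⟩ := Finset.card_pos.1 hpos
    simp only [Finset.mem_filter, Finset.mem_univ, true_and] at hx
    exact (Finset.sum_pos' (fun _ _ => Nat.zero_le _)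
      ⟨x, Finset.mem_univ x, unitWeight_pos.2 hx⟩).ne'

/-- The clause contains a positive literal. -/
def HasPos (C : Clause n) : Prop := ∃ x, (x, true) ∈ C

theorem setTrue_filter_hasPos (x : Fin n) (Φ : Formula n) :
    setTrue x (Φ.filter fun C => HasPos C) = (setTrue x Φ).filter fun C => HasPos C := by
  have h : ∀ C : Clause n, HasPos (C.erase (x, false)) ↔ HasPos C := fun C => by simp [HasPos]
  simp only [setTrue, List.filter_map, List.filter_filter, Function.comp_def, h]
  congr 1
  exact List.filter_congr fun C _ => Bool.and_comm _ _

theorem unitWeight_filter_hasPos (x : Fin n) (Φ : Formula n) :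
    unitWeight (Φ.filter fun C => HasPos C) x = unitWeight Φ x := by
  rw [unitWeight, List.count_filter (by simp [HasPos]), unitWeight]

/-- Deleting negative literals neither creates nor destroys positive ones, so purely negative
clauses never become positive units. This is the source of the independence between propagation and
rejection. -/
theorem chainProb_filter_hasPos (Φ : Formula n) (xs : List (Fin n)) :
    chainProb (Φ.filter fun C => HasPos C) xs = chainProb Φ xs := by
  induction xs generalizing Φ with
  | nil => rfl
  | cons x xs ih =>
    rw [chainProb, chainProb, setTrue_filter_hasPos, ih]
    simp only [stepProb, totalWeight, unitWeight_filter_hasPos]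

end

/-! ### Averages over sequences of clauses. -/

section

/-- The average of `F` over all functions `Fin m → α`. -/
def avg {α : Type*} [Fintype α] {m : ℕ} (F : (Fin m → α) → ℝ) : ℝ :=
  (∑ f, F f) / (Fintype.card α : ℝ) ^ m

section avg

variable {α : Type*} [Fintype α] {m : ℕ}

theorem avg_mono {F F' : (Fin m → α) → ℝ} (h : ∀ f, F f ≤ F' f) : avg F ≤ avg F' :=
  div_le_div_of_nonneg_right (Finset.sum_le_sum fun f _ => h f) (by positivity)

theorem avg_nonneg {F : (Fin m → α) → ℝ} (h : ∀ f, 0 ≤ F f) : 0 ≤ avg F :=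
  div_nonneg (Finset.sum_nonneg fun f _ => h f) (by positivity)

theorem avg_sub (F F' : (Fin m → α) → ℝ) : avg (fun f => F f - F' f) = avg F - avg F' := by
  simp [avg, sub_div]

theorem avg_add (F F' : (Fin m → α) → ℝ) : avg (fun f => F f + F' f) = avg F + avg F' := by
  simp [avg, Finset.sum_add_distrib, add_div]

theorem avg_sum {ι : Type*} (s : Finset ι) (F : ι → (Fin m → α) → ℝ) :
    avg (fun f => ∑ i ∈ s, F i f) = ∑ i ∈ s, avg (F i) := by
  simp only [avg]
  rw [Finset.sum_comm, Finset.sum_div]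

theorem avg_mul_const (F : (Fin m → α) → ℝ) (a : ℝ) : avg (fun f => F f * a) = avg F * a := by
  simp only [avg]
  rw [← Finset.sum_mul]
  ring

theorem avg_const [Nonempty α] (a : ℝ) : avg (fun _ : Fin m → α => a) = a := by
  have : (Fintype.card α : ℝ) ≠ 0 := by simp
  simp [avg, this]

theorem avg_prod (u : α → ℝ) :
    avg (fun f : Fin m → α => ∏ t, u (f t)) = ((∑ a, u a) / Fintype.card α) ^ m := by
  rw [avg, ← Fintype.sum_pow, div_pow]

theorem abs_avg_le_sqrt [Nonempty α] (F : (Fin m → α) → ℝ) :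
    avg (fun f => |F f|) ≤ √(avg fun f => F f ^ 2) := by
  refine Real.le_sqrt_of_sq_le ?_
  have h := sq_sum_le_card_mul_sum_sq (s := Finset.univ) (f := fun f : Fin m → α => |F f|)
  simp only [sq_abs] at h
  rw [Finset.card_univ, Fintype.card_fun, Fintype.card_fin] at h
  have h0 : (0 : ℝ) < (Fintype.card α : ℝ) ^ m := by
    have : (0 : ℝ) < Fintype.card α := by exact_mod_cast Fintype.card_pos
    positivity
  simp only [avg]
  rw [div_pow, div_le_div_iff₀ (by positivity) h0]
  push_cast at h
  nlinarith

theorem abs_avg_le (F : (Fin m → α) → ℝ) : |avg F| ≤ avg fun f => |F f| := by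
  rw [avg, avg, abs_div, abs_of_nonneg (show 0 ≤ (Fintype.card α : ℝ) ^ m by positivity)]
  gcongr
  exact Finset.abs_sum_le_sum_abs _ _

/-- The covariance with a `[0,1]`-valued variable is at most the mean absolute deviation of the
other factor, hence at most its standard deviation. -/
theorem abs_avg_mul_sub_le [Nonempty α] {R h : (Fin m → α) → ℝ} (h0 : ∀ f, 0 ≤ R f)
    (h1 : ∀ f, R f ≤ 1) :
    |avg (fun f => R f * h f) - avg R * avg h| ≤ √(avg (fun f => h f ^ 2) - avg h ^ 2) := by
  have e1 : avg (fun f => R f * h f) - avg R * avg h =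
      avg fun f => R f * (h f - avg h) := by
    rw [← avg_mul_const, ← avg_sub]
    congr 1; ext f; ring
  have e2 : avg (fun f => h f ^ 2) - avg h ^ 2 = avg fun f => (h f - avg h) ^ 2 := by
    have : (fun f => (h f - avg h) ^ 2) =
        fun f => (h f ^ 2 - h f * (2 * avg h)) + avg h ^ 2 := by
      ext f; ring
    rw [this, avg_add, avg_sub, avg_mul_const, avg_const]
    ring
  rw [e1, e2]
  refine (abs_avg_le _).trans (le_trans (avg_mono fun f => ?_) (abs_avg_le_sqrt _))
  rw [abs_mul, abs_of_nonneg (h0 f)]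
  exact mul_le_of_le_one_left (abs_nonneg _) (h1 f)

/-- The factors `u (f t)` may be redistributed inside the fibres of `κ`, when they are averaged
against a function of `κ ∘ f`. -/
theorem sum_mul_prod_congr {β : Type*} [Fintype β] [DecidableEq β] (κ : α → β) {u u' : α → ℝ}
    (h : ∀ b, ∑ a with κ a = b, u a = ∑ a with κ a = b, u' a) (F : (Fin m → β) → ℝ) :
    ∑ f : Fin m → α, F (κ ∘ f) * ∏ t, u (f t) = ∑ f : Fin m → α, F (κ ∘ f) * ∏ t, u' (f t) := by
  -- Grouping by `g = κ ∘ f` makes the product factor over positions, so that `w` enters only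
  -- through its fibre sums.
  have key : ∀ w : α → ℝ, ∑ f : Fin m → α, F (κ ∘ f) * ∏ t, w (f t) =
      ∑ g : Fin m → β, F g * ∏ t, ∑ a with κ a = g t, w a := fun w => by
    rw [← Finset.sum_fiberwise (Finset.univ : Finset (Fin m → α)) (fun f => κ ∘ f)]
    refine Finset.sum_congr rfl fun g _ => ?_
    rw [Finset.prod_univ_sum, Finset.mul_sum]
    refine Finset.sum_congr ?_ fun f hf => ?_
    · ext f
      simp [funext_iff]
    · simp only [Fintype.mem_piFinset, Finset.mem_filter, Finset.mem_univ, true_and] at hf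
      rw [show κ ∘ f = g from funext hf]
  rw [key, key]
  simp only [h]

theorem card_box {i : ℕ} (τ : Fin i ↪ Fin m) (A : Fin i → Finset α) (B : Finset α) :
    (Finset.univ.filter fun f : Fin m → α =>
      (∀ j, f (τ j) ∈ A j) ∧ ∀ s, s ∉ Set.range τ → f s ∈ B).card =
      (∏ j, (A j).card) * B.card ^ (m - i) := by
  let W : Fin m → Finset α := fun s => if h : ∃ j, τ j = s then A h.choose else B
  have hW : ∀ j, W (τ j) = A j := fun j => by
    have h : ∃ j', τ j' = τ j := ⟨j, rfl⟩
    simp only [W, dif_pos h]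
    rw [τ.injective h.choose_spec]
  have hW' : ∀ s, s ∉ Set.range τ → W s = B := fun s hs => dif_neg hs
  have e : (Finset.univ.filter fun f : Fin m → α =>
      (∀ j, f (τ j) ∈ A j) ∧ ∀ s, s ∉ Set.range τ → f s ∈ B) = Fintype.piFinset W := by
    ext f
    simp only [Finset.mem_filter, Finset.mem_univ, true_and, Fintype.mem_piFinset]
    constructor
    · rintro ⟨h1, h2⟩ s
      by_cases hs : s ∈ Set.range τ
      · obtain ⟨j, rfl⟩ := hs
        rw [hW]; exact h1 j
      · rw [hW' s hs]; exact h2 s hs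
    · intro h
      exact ⟨fun j => hW j ▸ h (τ j), fun s hs => hW' s hs ▸ h s⟩
  rw [e, Fintype.card_piFinset, ← Finset.prod_mul_prod_compl (Finset.univ.map τ),
    Finset.prod_map]
  congr 1
  · exact Finset.prod_congr rfl fun j _ => by rw [hW]
  · rw [Finset.prod_congr rfl fun s hs => by rw [hW' s (by simpa using hs)], Finset.prod_const,
      Finset.card_compl, Finset.card_map]
    simp

end avg

/-! ### Counting Horn clauses of a given shape. -/

section counting

variable {n : ℕ}

/-- The nonempty clauses made up of negations of variables of `S`. -/
def negSet (S : Finset (Fin n)) : Finset (HornClause n) :=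
  Finset.univ.filter fun C => C.1 ⊆ negClause S

/-- The clauses `x ∨ ¬y₁ ∨ ⋯ ∨ ¬yₖ` with all `yᵢ` in `S`. -/
def headSet (x : Fin n) (S : Finset (Fin n)) : Finset (HornClause n) :=
  Finset.univ.filter fun C => (x, true) ∈ C.1 ∧ C.1 ⊆ insert (x, true) (negClause S)

/-- The clauses which become positive unit clauses when the variables of `S` are set to `1`. -/
def unitSet (S : Finset (Fin n)) : Finset (HornClause n) := Sᶜ.biUnion fun x => headSet x S

theorem negClause_injective : Function.Injective (negClause (n := n)) :=
  Finset.image_injective fun _ _ h => (Prod.ext_iff.1 h).1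

theorem negClause_mono {S T : Finset (Fin n)} (h : S ⊆ T) : negClause S ⊆ negClause T :=
  Finset.image_subset_image h

theorem eq_negClause_filter {C : Clause n} {S : Finset (Fin n)} (h : C ⊆ negClause S) :
    C = negClause (S.filter fun x => (x, false) ∈ C) := by
  ext ⟨x, b⟩
  rw [mem_negClause, Finset.mem_filter]
  constructor
  · intro hx
    obtain ⟨h1, rfl⟩ := mem_negClause.1 (h hx)
    exact ⟨⟨h1, hx⟩, rfl⟩
  · rintro ⟨⟨-, hx⟩, rfl⟩
    exact hx

theorem isHorn_insert_negClause (x : Fin n) (S : Finset (Fin n)) :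
    Clause.IsHorn (insert (x, true) (negClause S)) := by
  refine (Finset.card_le_card (t := {(x, true)}) fun l hl => ?_).trans_eq
    (Finset.card_singleton _)
  simp only [Finset.mem_filter, Finset.mem_insert, mem_negClause] at hl
  rcases hl with ⟨h | h, h'⟩
  · simpa using h
  · simp [h.2] at h'

theorem card_negSet (S : Finset (Fin n)) : (negSet S).card = 2 ^ S.card - 1 := by
  rw [← Finset.card_powerset, ← Finset.card_erase_of_mem (Finset.empty_mem_powerset S)]
  symm
  refine Finset.card_bij (fun N hN => ⟨negClause N, ?_, ?_⟩) ?_ ?_ ?_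
  · rw [Finset.mem_erase] at hN
    exact (Finset.nonempty_iff_ne_empty.2 hN.1).image _
  · obtain rfl | hn := Finset.eq_empty_or_nonempty N
    · simp at hN
    · obtain ⟨x, -⟩ := hn
      exact IsHorn.mono (Finset.subset_insert _ _) (isHorn_insert_negClause x N)
  · intro N hN
    rw [Finset.mem_erase, Finset.mem_powerset] at hN
    exact Finset.mem_filter.2 ⟨Finset.mem_univ _, negClause_mono hN.2⟩
  · intro N _ N' _ h
    exact negClause_injective (congrArg Subtype.val h)
  · intro C hC
    simp only [negSet, Finset.mem_filter, Finset.mem_univ, true_and] at hC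
    have h := eq_negClause_filter hC
    refine ⟨_, Finset.mem_erase.2 ⟨fun h0 => ?_, Finset.mem_powerset.2 (Finset.filter_subset _ _)⟩,
      Subtype.ext h.symm⟩
    rw [h0] at h
    exact C.2.1.ne_empty (by simpa [negClause] using h)

theorem card_headSet (x : Fin n) (S : Finset (Fin n)) : (headSet x S).card = 2 ^ S.card := by
  rw [← Finset.card_powerset]
  symm
  refine Finset.card_bij (fun N hN => ⟨insert (x, true) (negClause N), by simp,
    isHorn_insert_negClause x N⟩) ?_ ?_ ?_
  · intro N hN
    rw [Finset.mem_powerset] at hN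
    exact Finset.mem_filter.2 ⟨Finset.mem_univ _, Finset.mem_insert_self _ _,
      Finset.insert_subset_insert _ (negClause_mono hN)⟩
  · intro N _ N' _ h
    have h' : insert (x, true) (negClause N) = insert (x, true) (negClause N') :=
      congrArg Subtype.val h
    ext y
    have := Finset.ext_iff.1 h' (y, false)
    simpa [mem_negClause] using this
  · intro C hC
    simp only [headSet, Finset.mem_filter, Finset.mem_univ, true_and] at hC
    refine ⟨S.filter fun y => (y, false) ∈ C.1, by simp, Subtype.ext ?_⟩
    ext ⟨y, b⟩
    simp only [Finset.mem_insert, mem_negClause, Finset.mem_filter, Prod.mk.injEq]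
    constructor
    · rintro (⟨rfl, rfl⟩ | ⟨⟨-, h⟩, rfl⟩)
      · exact hC.1
      · exact h
    · intro h
      have h1 := hC.2 h
      simp only [Finset.mem_insert, mem_negClause, Prod.mk.injEq] at h1
      rcases h1 with h1 | ⟨h1, rfl⟩
      · exact Or.inl h1
      · exact Or.inr ⟨⟨h1, h⟩, rfl⟩

theorem eq_of_mem_headSet {x y : Fin n} {S T : Finset (Fin n)} {C : HornClause n}
    (hx : C ∈ headSet x S) (hy : C ∈ headSet y T) : x = y := by
  simp only [headSet, Finset.mem_filter, Finset.mem_univ, true_and] at hx hy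
  have := hy.2 hx.1
  simpa [mem_negClause] using this

theorem card_unitSet (S : Finset (Fin n)) : (unitSet S).card = (n - S.card) * 2 ^ S.card := by
  rw [unitSet, Finset.card_biUnion]
  · simp [card_headSet, Finset.card_compl]
  · intro x _ y _ hxy
    exact Finset.disjoint_left.2 fun C hC hC' => hxy (eq_of_mem_headSet hC hC')

theorem mem_negSet_univ {C : HornClause n} : C ∈ negSet Finset.univ ↔ ¬ HasPos C.1 := by
  simp only [negSet, Finset.mem_filter, Finset.mem_univ, true_and, HasPos, not_exists]
  constructor
  · intro h x hx
    simpa [mem_negClause] using h hx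
  · rintro h ⟨x, b⟩ hx
    cases b
    · simp [mem_negClause]
    · exact absurd hx (h x)

theorem mem_headSet_univ {C : HornClause n} {x : Fin n} :
    C ∈ headSet x Finset.univ ↔ (x, true) ∈ C.1 := by
  simp only [headSet, Finset.mem_filter, Finset.mem_univ, true_and, and_iff_left_iff_imp]
  rintro hx ⟨y, b⟩ hy
  cases b
  · simp [mem_negClause]
  · have := Finset.card_le_one.1 C.2.2 (x, true) (by simp [hx]) (y, true) (by simp [hy])
    simp [this]

theorem card_hornClause (n : ℕ) : Fintype.card (HornClause n) = (n + 1) * 2 ^ n - 1 := by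
  have e : (Finset.univ : Finset (HornClause n)) =
      negSet Finset.univ ∪ Finset.univ.biUnion fun x => headSet x Finset.univ := by
    ext C
    simp only [Finset.mem_univ, Finset.mem_union, mem_negSet_univ, Finset.mem_biUnion, true_and,
      mem_headSet_univ, HasPos]
    tauto
  rw [← Finset.card_univ, e, Finset.card_union_of_disjoint, card_negSet, Finset.card_biUnion]
  · simp only [card_headSet, Finset.card_univ, Fintype.card_fin, Finset.sum_const, smul_eq_mul]
    have := Nat.one_le_two_pow (n := n)
    rw [add_mul]
    omega
  · intro x _ y _ hxy
    exact Finset.disjoint_left.2 fun C hC hC' => hxy (eq_of_mem_headSet hC hC')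
  · refine Finset.disjoint_left.2 fun C hC hC' => mem_negSet_univ.1 hC ?_
    simp only [Finset.mem_biUnion, Finset.mem_univ, true_and, mem_headSet_univ] at hC'
    exact hC'

end counting

end

/-! ### Averaging out the purely negative clauses. -/

section

variable {n m : ℕ}

/-- The formula with the given sequence of clauses. -/
def toFormula (f : Fin m → HornClause n) : Formula n := List.ofFn fun t => (f t : Clause n)

/-- The proportion of the purely negative clauses which lie below a set of `i` variables. -/
def negRatio (n i : ℕ) : ℝ := (2 ^ i - 1) / (2 ^ n - 1)

/-- The conditional probability, given which clauses are purely negative, that none of them lies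
below a fixed set of `i` variables. -/
def negWeight (i : ℕ) (f : Fin m → HornClause n) : ℝ :=
  ∏ t, if HasPos (f t : Clause n) then 1 else 1 - negRatio n i

theorem mem_toFormula {f : Fin m → HornClause n} {C : Clause n} :
    C ∈ toFormula f ↔ ∃ t, (f t : Clause n) = C := by
  simp [toFormula, List.mem_ofFn]

theorem not_empty_mem_toFormula (f : Fin m → HornClause n) : (∅ : Clause n) ∉ toFormula f := by
  rw [mem_toFormula]
  rintro ⟨t, ht⟩
  exact (f t).2.1.ne_empty ht

theorem isHorn_of_mem_toFormula {f : Fin m → HornClause n} {C : Clause n}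
    (h : C ∈ toFormula f) : C.IsHorn := by
  obtain ⟨t, rfl⟩ := mem_toFormula.1 h
  exact (f t).2.2

/-- Purely negative clauses are replaced by the empty clause. -/
def posPart (C : Clause n) : Clause n := if HasPos C then C else ∅

theorem hasPos_posPart {C : Clause n} : HasPos (posPart C) ↔ HasPos C := by
  unfold posPart
  split_ifs with h
  · rfl
  · exact iff_of_false (by simp [HasPos]) h

theorem filter_map_posPart (Φ : Formula n) :
    (Φ.map posPart).filter (fun C => HasPos C) = Φ.filter fun C => HasPos C := by
  induction Φ with
  | nil => rfl
  | cons C Φ ih =>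
    rw [List.map_cons, List.filter_cons, List.filter_cons, ih]
    simp only [hasPos_posPart, decide_eq_true_eq]
    split_ifs with h
    · rw [posPart, if_pos h]
    · rfl

theorem chainProb_toFormula (f : Fin m → HornClause n) (xs : List (Fin n)) :
    chainProb (toFormula f) xs =
      chainProb (List.ofFn ((fun C : HornClause n => posPart C.1) ∘ f)) xs := by
  rw [← chainProb_filter_hasPos, ← filter_map_posPart, chainProb_filter_hasPos, toFormula,
    List.map_ofFn]
  rfl

theorem two_pow_sub_one_pos (hn : 1 ≤ n) : (0 : ℝ) < 2 ^ n - 1 :=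
  sub_pos.2 (one_lt_pow₀ (by norm_num) (by omega))

theorem card_negSet_real (S : Finset (Fin n)) : ((negSet S).card : ℝ) = 2 ^ S.card - 1 := by
  rw [card_negSet, Nat.cast_sub Nat.one_le_two_pow]
  simp

theorem sum_not_mem_negSet (hn : 1 ≤ n) (S : Finset (Fin n)) :
    ∑ a ∈ negSet (n := n) Finset.univ, (if a ∈ negSet S then 0 else 1 : ℝ) =
      ∑ _a ∈ negSet (n := n) Finset.univ, (1 - negRatio n S.card) := by
  have hsub : negSet S ⊆ negSet Finset.univ := fun C hC => by
    simp only [negSet, Finset.mem_filter, Finset.mem_univ, true_and] at hC ⊢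
    exact hC.trans (negClause_mono (Finset.subset_univ _))
  have e : ∀ a : HornClause n, (if a ∈ negSet S then 0 else 1 : ℝ) =
      1 - if a ∈ negSet S then 1 else 0 := fun _ => by split_ifs <;> ring
  simp only [e]
  rw [Finset.sum_sub_distrib, Finset.sum_sub_distrib]
  congr 1
  rw [← Finset.sum_filter, Finset.filter_mem_eq_inter, Finset.inter_eq_right.2 hsub]
  simp only [Finset.sum_const, nsmul_eq_mul, card_negSet_real, negRatio, Finset.card_univ,
    Fintype.card_fin]
  have := (two_pow_sub_one_pos hn).ne'
  field_simp

/-- Conditioning on the image of `f` under `posPart`: the chain probability is a function of it, and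
the indicator is replaced by its conditional expectation. -/
theorem sum_chainProb_mul_indicator (hn : 1 ≤ n) (xs : List (Fin n)) (S : Finset (Fin n)) :
    ∑ f : Fin m → HornClause n, chainProb (toFormula f) xs *
        (if ∀ C ∈ toFormula f, ¬ C ⊆ negClause S then 1 else 0) =
      ∑ f : Fin m → HornClause n, chainProb (toFormula f) xs * negWeight S.card f := by
  have h1 : ∀ f : Fin m → HornClause n,
      (if ∀ C ∈ toFormula f, ¬ C ⊆ negClause S then 1 else 0 : ℝ) =
        ∏ t, if f t ∈ negSet S then 0 else 1 := fun f => by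
    split_ifs with h
    · refine (Finset.prod_eq_one fun t _ => if_neg fun ht => ?_).symm
      exact h _ (mem_toFormula.2 ⟨t, rfl⟩) (by simpa [negSet] using ht)
    · push Not at h
      obtain ⟨C, hC, hs⟩ := h
      obtain ⟨t, rfl⟩ := mem_toFormula.1 hC
      exact (Finset.prod_eq_zero (f := fun t => if f t ∈ negSet S then (0 : ℝ) else 1)
        (Finset.mem_univ t) (if_pos (by simpa [negSet] using hs))).symm
  simp only [h1, chainProb_toFormula, negWeight]
  refine sum_mul_prod_congr (fun C : HornClause n => posPart C.1)
    (u := fun a => if a ∈ negSet S then 0 else 1)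
    (u' := fun a => if HasPos a.1 then 1 else 1 - negRatio n S.card) (fun b => ?_)
    (fun g => chainProb (List.ofFn g) xs)
  by_cases hb : HasPos b
  · refine Finset.sum_congr rfl fun a ha => ?_
    simp only [Finset.mem_filter, Finset.mem_univ, true_and] at ha
    have hp : HasPos a.1 := by rw [← hasPos_posPart, ha]; exact hb
    rw [if_pos hp, if_neg]
    obtain ⟨x, hx⟩ := hp
    intro hS
    simp only [negSet, Finset.mem_filter, Finset.mem_univ, true_and] at hS
    simpa [mem_negClause] using hS hx
  -- Since Horn clauses here are nonempty, the fibre over `∅` consists of exactly the purely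
  -- negative clauses. The fibre over any other `b` without a positive literal is empty.
  · by_cases hb0 : b = ∅
    · have e : (Finset.univ.filter fun a : HornClause n => posPart a.1 = b) =
          negSet Finset.univ := by
        ext a
        rw [mem_negSet_univ]
        simp only [Finset.mem_filter, Finset.mem_univ, true_and, hb0, posPart]
        split_ifs with h
        · simp only [h, not_true_eq_false, iff_false]
          exact a.2.1.ne_empty
        · simp [h]
      rw [e, sum_not_mem_negSet hn]
      exact Finset.sum_congr rfl fun a ha => (if_neg (mem_negSet_univ.1 ha)).symm
    · have e : (Finset.univ.filter fun a : HornClause n => posPart a.1 = b) = ∅ := by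
        refine Finset.filter_eq_empty_iff.2 fun a _ ha => ?_
        by_cases h : HasPos a.1
        · rw [← hasPos_posPart, ha] at h
          exact hb h
        · exact hb0 (by rw [← ha, posPart, if_neg h])
      rw [e]; simp

/-- Chains of positive probability have no repetitions, so their initial segments have exactly `i`
and `i + 1` variables, and the conditional survival probabilities no longer depend on the chain. -/
theorem avg_PUR_false (hn : 1 ≤ n) (i : ℕ) :
    avg (fun f : Fin m → HornClause n => (PUR (toFormula f) (false, i)).toReal) =
      avg fun f : Fin m → HornClause n =>
        reach (toFormula f) (i + 1) * (negWeight i f - negWeight (i + 1) f) := by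
  unfold avg
  congr 1
  simp only [PUR_false_eq_sum, reach, Finset.sum_mul]
  rw [Finset.sum_comm, Finset.sum_comm (γ := Fin m → HornClause n)]
  refine Finset.sum_congr rfl fun v _ => ?_
  by_cases hv : (List.ofFn v).Nodup
  · simp only [survives_iff (not_empty_mem_toFormula _), mul_sub, Finset.sum_sub_distrib]
    rw [sum_chainProb_mul_indicator hn, sum_chainProb_mul_indicator hn,
      List.toFinset_card_of_nodup hv,
      List.toFinset_card_of_nodup (hv.sublist (List.take_sublist _ _))]
    simp
  · have h0 : ∀ f : Fin m → HornClause n, chainProb (toFormula f) (List.ofFn v) = 0 :=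
      fun f => by_contra fun h => hv (nodup_of_chainProb_ne_zero h)
    simp only [h0, zero_mul]

theorem PUR_false_eq_zero (Φ : Formula n) {i : ℕ} (h : n ≤ i) : PUR Φ (false, i) = 0 := by
  have h1 : (PUR Φ (false, i)).toReal = 0 := by
    rw [PUR_false_eq_sum]
    refine Finset.sum_eq_zero fun v _ => ?_
    rw [by_contra fun h0 : ¬ chainProb Φ (List.ofFn v) = 0 => ?_, zero_mul]
    have h2 := List.nodup_ofFn.1 (nodup_of_chainProb_ne_zero h0)
    have := Fintype.card_le_of_injective v h2
    simp at this
    omega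
  exact ((ENNReal.toReal_eq_zero_iff _).1 h1).resolve_right (PMF.apply_ne_top _ _)

theorem PUR_true_eq_zero {f : Fin m → HornClause n} (h : ¬ (toFormula f).Satisfiable) (i : ℕ) :
    PUR (toFormula f) (true, i) = 0 := by
  by_contra h0
  exact h ((PUR_answer (not_empty_mem_toFormula f) (fun C => isHorn_of_mem_toFormula)
    ((PMF.mem_support_iff _ _).2 h0)).1 rfl)

theorem PUR_false_eq_zero_of_satisfiable {f : Fin m → HornClause n}
    (h : (toFormula f).Satisfiable) (i : ℕ) : PUR (toFormula f) (false, i) = 0 := by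
  by_contra h0
  simpa using (PUR_answer (not_empty_mem_toFormula f) (fun C => isHorn_of_mem_toFormula)
    ((PMF.mem_support_iff _ _).2 h0)).2 h

theorem sum_PUR_false (f : Fin m → HornClause n) :
    ∑ i ∈ Finset.range n, (PUR (toFormula f) (false, i)).toReal =
      if (toFormula f).Satisfiable then 0 else 1 := by
  split_ifs with h
  · simp [PUR_false_eq_zero_of_satisfiable h]
  · rw [← ENNReal.toReal_sum fun i _ => PMF.apply_ne_top _ _, ← ENNReal.toReal_one]
    congr 1
    rw [← (PUR (toFormula f)).tsum_coe, tsum_eq_sum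
      (s := (Finset.range n).image fun i => (false, i))]
    · exact (Finset.sum_image fun _ _ _ _ h => (Prod.ext_iff.1 h).2).symm
    · rintro ⟨b, i⟩ hb
      cases b
      · exact PUR_false_eq_zero _ (by simpa using hb)
      · exact PUR_true_eq_zero h i

theorem toReal_toOuterMeasure_runLaw [NeZero n] (A : Set (Formula n × ℕ)) :
    prob (runLaw n m) A = avg fun f : Fin m → HornClause n =>
      ((PUR (toFormula f)).toOuterMeasure {r | (toFormula f, r.2) ∈ A}).toReal := by
  have hle : ∀ (p : PMF (Bool × ℕ)) s, p.toOuterMeasure s ≠ ⊤ := fun p s =>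
    ne_top_of_le_ne_top (b := 1) (by simp) (by
      rw [← (p.toOuterMeasure_apply_eq_one_iff Set.univ).2 (Set.subset_univ _)]
      exact p.toOuterMeasure.mono (Set.subset_univ s))
  rw [prob, runLaw, randomFormula, PMF.bind_map, PMF.toOuterMeasure_bind_apply, tsum_fintype,
    ENNReal.toReal_sum, avg, Finset.sum_div]
  · refine Finset.sum_congr rfl fun f _ => ?_
    rw [ENNReal.toReal_mul, PMF.uniformOfFintype_apply, Function.comp_apply,
      PMF.toOuterMeasure_map_apply, Fintype.card_fun, Fintype.card_fin]
    simp only [ENNReal.toReal_inv, Nat.cast_pow]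
    rw [mul_comm, div_eq_mul_inv]
    rfl
  · intro f _
    refine ENNReal.mul_ne_top (PMF.apply_ne_top _ _) ?_
    rw [Function.comp_apply, PMF.toOuterMeasure_map_apply]
    exact hle _ _

theorem prob_iterations_inter_unsat [NeZero n] (i : ℕ) :
    prob (runLaw n m) ({ω | (ω.2 : ℤ) = i} ∩ {ω | ¬ ω.1.Satisfiable}) =
      avg fun f : Fin m → HornClause n => (PUR (toFormula f) (false, i)).toReal := by
  rw [toReal_toOuterMeasure_runLaw]
  congr 1
  ext f
  congr 1
  by_cases h : (toFormula f).Satisfiable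
  · simp [h, PUR_false_eq_zero_of_satisfiable h]
  · have e : {r : Bool × ℕ | (toFormula f, r.2) ∈ {ω : Formula n × ℕ | (ω.2 : ℤ) = i} ∩
        {ω | ¬ ω.1.Satisfiable}} = ((({(false, i), (true, i)} : Finset (Bool × ℕ))) : Set _) := by
      ext ⟨b, j⟩
      cases b <;> simp [h]
    rw [e, PMF.toOuterMeasure_apply_finset, Finset.sum_pair (by simp), PUR_true_eq_zero h,
      add_zero]

theorem prob_unsat [NeZero n] :
    prob (runLaw n m) {ω | ¬ ω.1.Satisfiable} = ∑ i ∈ Finset.range n,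
      avg fun f : Fin m → HornClause n => (PUR (toFormula f) (false, i)).toReal := by
  rw [toReal_toOuterMeasure_runLaw, ← avg_sum]
  congr 1
  ext f
  rw [sum_PUR_false]
  split_ifs with h
  · simp [h]
  · have e : {r : Bool × ℕ | (toFormula f, r.2) ∈ {ω : Formula n × ℕ | ¬ ω.1.Satisfiable}} =
        Set.univ := Set.eq_univ_of_forall fun r => h
    rw [e, (PMF.toOuterMeasure_apply_eq_one_iff _ _).2 (Set.subset_univ _)]
    simp

/-! ### First and second moments of `negWeight`. -/

section negWeight

variable {i : ℕ}

theorem negRatio_nonneg (hn : 1 ≤ n) : 0 ≤ negRatio n i :=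
  div_nonneg (sub_nonneg.2 (one_le_pow₀ (by norm_num))) (two_pow_sub_one_pos hn).le

theorem negRatio_le_one (hn : 1 ≤ n) (hi : i ≤ n) : negRatio n i ≤ 1 := by
  rw [negRatio, div_le_one (two_pow_sub_one_pos hn)]
  gcongr
  norm_num

theorem negWeight_nonneg (hn : 1 ≤ n) (hi : i ≤ n) (f : Fin m → HornClause n) :
    0 ≤ negWeight i f :=
  Finset.prod_nonneg fun t _ => by
    have := negRatio_le_one hn hi
    split_ifs <;> linarith

theorem negWeight_le_one (hn : 1 ≤ n) (hi : i ≤ n) (f : Fin m → HornClause n) :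
    negWeight i f ≤ 1 :=
  Finset.prod_le_one (fun t _ => by
    have := negRatio_le_one hn hi
    split_ifs <;> linarith) fun t _ => by
    have := negRatio_nonneg (i := i) hn
    split_ifs <;> linarith

theorem negWeight_succ_le (hn : 1 ≤ n) (hi : i + 1 ≤ n) (f : Fin m → HornClause n) :
    negWeight (i + 1) f ≤ negWeight i f := by
  refine Finset.prod_le_prod (fun t _ => ?_) fun t _ => ?_
  · have := negRatio_le_one hn hi
    split_ifs <;> linarith
  · have : negRatio n i ≤ negRatio n (i + 1) := by
      unfold negRatio
      have := two_pow_sub_one_pos hn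
      gcongr
      · norm_num
      · omega
    split_ifs <;> linarith

theorem negWeight_zero (f : Fin m → HornClause n) : negWeight 0 f = 1 := by
  simp [negWeight, negRatio]

theorem sum_ite_hasPos (z : ℝ) :
    ∑ a : HornClause n, (if HasPos a.1 then 1 else 1 - z) =
      Fintype.card (HornClause n) - (2 ^ n - 1) * z := by
  have e : ∀ a : HornClause n, (if HasPos a.1 then 1 else 1 - z) =
      1 - if a ∈ negSet Finset.univ then z else 0 := fun a => by
    simp only [mem_negSet_univ]
    split_ifs <;> simp_all
  simp only [e]
  rw [Finset.sum_sub_distrib, ← Finset.sum_filter, Finset.filter_mem_eq_inter,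
    Finset.univ_inter, Finset.sum_const, Finset.sum_const, nsmul_eq_mul, nsmul_eq_mul,
    card_negSet_real]
  simp

variable [Nonempty (HornClause n)]

theorem avg_negWeight (hn : 1 ≤ n) :
    avg (fun f : Fin m → HornClause n => negWeight i f) =
      (1 - (2 ^ i - 1) / Fintype.card (HornClause n)) ^ m := by
  unfold negWeight
  rw [avg_prod fun a : HornClause n => if HasPos a.1 then 1 else 1 - negRatio n i,
    sum_ite_hasPos, negRatio]
  have h1 := (two_pow_sub_one_pos hn).ne'
  have h2 : (Fintype.card (HornClause n) : ℝ) ≠ 0 := by simp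
  congr 1
  field_simp

theorem avg_negWeight_sq (hn : 1 ≤ n) :
    avg (fun f : Fin m → HornClause n => negWeight i f ^ 2) =
      (1 - 2 * ((2 ^ i - 1) / Fintype.card (HornClause n)) +
        (2 ^ i - 1) ^ 2 / ((2 ^ n - 1) * Fintype.card (HornClause n))) ^ m := by
  have e : (fun f : Fin m → HornClause n => negWeight i f ^ 2) = fun f => ∏ t,
      if HasPos (f t : Clause n) then 1 else 1 - (2 * negRatio n i - negRatio n i ^ 2) := by
    ext f
    rw [negWeight, ← Finset.prod_pow]
    refine Finset.prod_congr rfl fun t _ => ?_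
    split_ifs <;> ring
  rw [e, avg_prod fun a : HornClause n => if HasPos a.1 then 1 else
    1 - (2 * negRatio n i - negRatio n i ^ 2), sum_ite_hasPos, negRatio]
  have h1 := (two_pow_sub_one_pos hn).ne'
  have h2 : (Fintype.card (HornClause n) : ℝ) ≠ 0 := by simp
  congr 1
  field_simp
  ring

end negWeight

end

/-! ### Moment bounds for the length of the propagation. -/

section

variable {n m : ℕ}

/-- The positions `τ` of `f` hold clauses from the sets `A j`, and the other ones clauses outside
of `B`. -/
def InBox {i : ℕ} (τ : Fin i ↪ Fin m) (A : Fin i → Finset (HornClause n))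
    (B : Finset (HornClause n)) (f : Fin m → HornClause n) : Prop :=
  (∀ j, f (τ j) ∈ A j) ∧ ∀ s, s ∉ Set.range τ → f s ∈ Bᶜ

theorem sum_inBox {i : ℕ} (τ : Fin i ↪ Fin m) (A : Fin i → Finset (HornClause n))
    (B : Finset (HornClause n)) :
    ∑ f : Fin m → HornClause n, (if InBox τ A B f then 1 else 0 : ℝ) =
      (∏ j, ((A j).card : ℝ)) * (Fintype.card (HornClause n) - B.card : ℝ) ^ (m - i) := by
  have h := card_box τ A Bᶜ
  rw [Finset.card_compl] at h
  have h' : ((Finset.univ.filter fun f => InBox τ A B f).card : ℝ) =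
      (∏ j, ((A j).card : ℝ)) * (Fintype.card (HornClause n) - B.card : ℝ) ^ (m - i) := by
    rw [← Nat.cast_sub (Finset.card_le_univ B)]
    norm_cast
    rw [← h]
    congr!
  rw [Finset.sum_boole, h']

/-- The variables set before the `j`-th step. -/
def before {i : ℕ} (v : Fin i → Fin n) (j : Fin i) : Finset (Fin n) :=
  ((List.ofFn v).take j).toFinset

theorem card_before_le {i : ℕ} (v : Fin i → Fin n) (j : Fin i) : (before v j).card ≤ j :=
  (List.toFinset_card_le _).trans (by simp)

/-- The positions `τ j` hold the clauses that produced the successive variables. No other position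
holds a clause that would be a positive unit now. -/
theorem exists_inBox {i : ℕ} {v : Fin i → Fin n} {f : Fin m → HornClause n}
    (h : chainProb (toFormula f) (List.ofFn v) ≠ 0)
    (h0 : totalWeight ((List.ofFn v).foldl (fun Φ y => setTrue y Φ) (toFormula f)) = 0) :
    ∃ τ : Fin i ↪ Fin m, InBox τ (fun j => headSet (v j) (before v j))
      (unitSet (List.ofFn v).toFinset) f := by
  have hinj : Function.Injective v := List.nodup_ofFn.1 (nodup_of_chainProb_ne_zero h)
  have hex : ∀ j : Fin i, ∃ t, f t ∈ headSet (v j) (before v j) := fun j => by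
    obtain ⟨C, hC, h1, h2⟩ := exists_clause_of_chainProb_ne_zero h j (by simp)
    obtain ⟨t, rfl⟩ := mem_toFormula.1 hC
    refine ⟨t, ?_⟩
    simp only [List.getElem_ofFn, Fin.eta] at h1 h2
    exact Finset.mem_filter.2 ⟨Finset.mem_univ _, h1, h2⟩
  choose τ hτ using hex
  refine ⟨⟨τ, fun j j' hj => hinj (eq_of_mem_headSet (hτ j) (hj ▸ hτ j'))⟩, hτ, fun s _ => ?_⟩
  rw [Finset.mem_compl, unitSet, Finset.mem_biUnion]
  rintro ⟨x, hx, hs⟩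
  simp only [headSet, Finset.mem_filter, Finset.mem_univ, true_and] at hs
  have h1 := mem_foldl_setTrue (mem_toFormula.2 ⟨s, rfl⟩) (by simpa using hx) hs.1 hs.2
  rw [totalWeight, Finset.sum_eq_zero_iff] at h0
  exact (unitWeight_pos.2 h1).ne' (h0 x (Finset.mem_univ x))

theorem reach_sub_le_sum {i : ℕ} (f : Fin m → HornClause n) :
    reach (toFormula f) i - reach (toFormula f) (i + 1) ≤
      ∑ v : Fin i → Fin n, if Function.Injective v then
        ∑ τ : Fin i ↪ Fin m, (if InBox τ (fun j => headSet (v j) (before v j))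
          (unitSet (List.ofFn v).toFinset) f then 1 else 0 : ℝ) else 0 := by
  rw [reach_sub_reach_succ]
  refine Finset.sum_le_sum fun v _ => ?_
  by_cases h : chainProb (toFormula f) (List.ofFn v) = 0
  · rw [h, zero_mul]
    split_ifs
    · exact Finset.sum_nonneg fun τ _ => by split_ifs <;> simp
    · exact le_rfl
  · rw [if_pos (List.nodup_ofFn.1 (nodup_of_chainProb_ne_zero h))]
    split_ifs with h0
    · obtain ⟨τ, hτ⟩ := exists_inBox h h0
      rw [mul_one]
      refine (chainProb_le_one _ _).trans ?_
      have := Finset.single_le_sum (f := fun τ : Fin i ↪ Fin m =>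
        (if InBox τ (fun j => headSet (v j) (before v j))
          (unitSet (List.ofFn v).toFinset) f then 1 else 0 : ℝ))
        (fun τ _ => by split_ifs <;> simp) (Finset.mem_univ τ)
      simpa [hτ] using this
    · rw [mul_zero]
      exact Finset.sum_nonneg fun τ _ => by split_ifs <;> simp

/-- A union bound over the order of the variables (`n^i`) and the positions of their clauses (at
most `m^i`). Each of these clauses has at most `2^i` possible bodies, and all others avoid the `(n -
i) * 2^i` clauses that would continue the propagation. -/
theorem sum_reach_sub_le {i : ℕ} (hi : i ≤ n) :
    ∑ f : Fin m → HornClause n, (reach (toFormula f) i - reach (toFormula f) (i + 1)) ≤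
      (n * m : ℝ) ^ i * 2 ^ (i * i) *
        (Fintype.card (HornClause n) - (n - i) * 2 ^ i : ℝ) ^ (m - i) := by
  refine (Finset.sum_le_sum fun f _ => reach_sub_le_sum f).trans ?_
  rw [Finset.sum_comm]
  have hcard : ∀ S : Finset (Fin n), S.card = i → ((unitSet S).card : ℝ) = (n - i) * 2 ^ i :=
    fun S hS => by rw [card_unitSet, hS, Nat.cast_mul, Nat.cast_sub hi]; simp
  obtain ⟨S, hS⟩ := Finset.exists_subset_card_eq (s := (Finset.univ : Finset (Fin n))) (n := i)
    (by simpa using hi)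
  have hpos : (0 : ℝ) ≤ Fintype.card (HornClause n) - (n - i) * 2 ^ i := by
    rw [← hcard S hS.2, sub_nonneg]
    exact_mod_cast Finset.card_le_univ _
  have key : ∀ v : Fin i → Fin n, ∑ f : Fin m → HornClause n, (if Function.Injective v then
      ∑ τ : Fin i ↪ Fin m, (if InBox τ (fun j => headSet (v j) (before v j))
        (unitSet (List.ofFn v).toFinset) f then 1 else 0 : ℝ) else 0) ≤
      (m : ℝ) ^ i * (2 ^ (i * i) *
        (Fintype.card (HornClause n) - (n - i) * 2 ^ i : ℝ) ^ (m - i)) := fun v => by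
    split_ifs with hv
    · rw [Finset.sum_comm]
      have hS' : (List.ofFn v).toFinset.card = i := by
        rw [List.toFinset_card_of_nodup (List.nodup_ofFn.2 hv), List.length_ofFn]
      simp only [sum_inBox, hcard _ hS']
      rw [Finset.sum_const, Finset.card_univ, Fintype.card_embedding_eq, Fintype.card_fin,
        Fintype.card_fin, nsmul_eq_mul]
      gcongr
      · exact_mod_cast Nat.descFactorial_le_pow m i
      · calc ∏ j, ((headSet (v j) (before v j)).card : ℝ) ≤ ∏ _j : Fin i, (2 : ℝ) ^ i := by
              refine Finset.prod_le_prod (fun _ _ => by positivity) fun j _ => ?_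
              rw [card_headSet]
              push_cast
              gcongr
              · norm_num
              · exact (card_before_le v j).trans j.2.le
          _ = 2 ^ (i * i) := by simp [pow_mul]
    · rw [Finset.sum_const_zero]
      positivity
  refine (Finset.sum_le_sum fun v _ => key v).trans_eq ?_
  rw [Finset.sum_const, Finset.card_univ, Fintype.card_fun, Fintype.card_fin, Fintype.card_fin,
    nsmul_eq_mul, mul_pow]
  push_cast
  ring

/-- A nonzero term means that `f` contains exactly `a` positive unit clauses, on distinct variables,
which forces `reach` to be 1. The factor `a ^ a` generously bounds the orders in which they can be
listed. -/
theorem sum_inBox_unit_le {a : ℕ} (f : Fin m → HornClause n) :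
    ∑ τ : Fin a ↪ Fin m, ∑ σ : Fin a ↪ Fin n,
      (if InBox τ (fun j => headSet (σ j) ∅) (unitSet ∅) f then 1 else 0 : ℝ) ≤
      a ^ a * reach (toFormula f) a := by
  rw [← Fintype.sum_prod_type', Finset.sum_boole]
  set s := Finset.univ.filter fun p : (Fin a ↪ Fin m) × (Fin a ↪ Fin n) =>
    InBox p.1 (fun j => headSet (p.2 j) ∅) (unitSet ∅) f with hs
  have hmem : ∀ p ∈ s, ∀ j, f (p.1 j) ∈ headSet (p.2 j) ∅ := fun p hp => by
    rw [hs, Finset.mem_filter] at hp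
    exact hp.2.1
  have hrange : ∀ p ∈ s, ∀ t, t ∈ Set.range p.1 ↔ f t ∈ unitSet ∅ := fun p hp t => by
    constructor
    · rintro ⟨j, rfl⟩
      exact Finset.mem_biUnion.2 ⟨p.2 j, by simp, hmem p hp j⟩
    · intro ht
      by_contra h
      rw [hs, Finset.mem_filter] at hp
      exact Finset.mem_compl.1 (hp.2.2 t h) ht
  obtain h0 | ⟨p₀, hp₀⟩ := s.eq_empty_or_nonempty
  · rw [h0]
    have := reach_nonneg (toFormula f) a
    simp only [Finset.card_empty, Nat.cast_zero]
    positivity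
  · have hreach : reach (toFormula f) a = 1 := by
      refine reach_eq_one ?_
      calc a = (Finset.univ.map p₀.2).card := by simp
        _ ≤ _ := Finset.card_le_card fun x hx => ?_
      obtain ⟨j, -, rfl⟩ := Finset.mem_map.1 hx
      have h1 := hmem p₀ hp₀ j
      simp only [headSet, Finset.mem_filter, Finset.mem_univ, true_and] at h1 ⊢
      refine mem_toFormula.2 ⟨p₀.1 j, Finset.Subset.antisymm ?_ (by simpa using h1.1)⟩
      simpa [negClause] using h1.2
    rw [hreach, mul_one]
    -- All pairs in `s` have the same set of positions, namely those of the unit clauses of `f`. A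
    -- pair is therefore determined by how it reindexes the positions of `p₀`.
    have hex : ∀ p : (Fin a ↪ Fin m) × (Fin a ↪ Fin n), ∃ g : Fin a → Fin a,
        p ∈ s → ∀ j, p₀.1 (g j) = p.1 j := fun p => by
      by_cases hp : p ∈ s
      · have : ∀ j, ∃ j', p₀.1 j' = p.1 j := fun j =>
          (hrange p₀ hp₀ _).2 ((hrange p hp _).1 ⟨j, rfl⟩)
        choose g hg using this
        exact ⟨g, fun _ => hg⟩
      · exact ⟨id, fun h => absurd h hp⟩
    choose g hg using hex
    have h2 := Finset.card_le_card_of_injOn (s := s) (t := Finset.univ) g (fun _ _ => by simp)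
      (fun p hp q hq hpq => by
        have h1 : p.1 = q.1 := by
          ext j
          rw [← hg p hp j, ← hg q hq j, hpq]
        refine Prod.ext h1 ?_
        ext j
        have h3 := hmem p hp j
        rw [h1] at h3
        rw [eq_of_mem_headSet h3 (hmem q hq j)])
    simp only [Finset.card_univ, Fintype.card_fun, Fintype.card_fin] at h2
    exact_mod_cast h2

theorem le_sum_reach (a : ℕ) :
    (m.descFactorial a * n.descFactorial a : ℝ) *
        (Fintype.card (HornClause n) - n : ℝ) ^ (m - a) ≤
      a ^ a * ∑ f : Fin m → HornClause n, reach (toFormula f) a := by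
  rw [Finset.mul_sum]
  refine le_trans (le_of_eq ?_) (Finset.sum_le_sum fun f _ => sum_inBox_unit_le f)
  rw [Finset.sum_comm]
  have e : ∀ τ : Fin a ↪ Fin m, ∑ f : Fin m → HornClause n, ∑ σ : Fin a ↪ Fin n,
      (if InBox τ (fun j => headSet (σ j) ∅) (unitSet ∅) f then 1 else 0 : ℝ) =
      n.descFactorial a * (Fintype.card (HornClause n) - n : ℝ) ^ (m - a) := fun τ => by
    rw [Finset.sum_comm]
    simp only [sum_inBox, card_headSet, card_unitSet]
    simp [Fintype.card_embedding_eq]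
  rw [Finset.sum_congr rfl fun τ _ => e τ]
  simp [Fintype.card_embedding_eq, mul_assoc]

/-! ### The bounds at density `m ≈ c * 2^n`. -/

section bounds

variable {c : ℝ}

theorem card_hornClause_real (n : ℕ) :
    (Fintype.card (HornClause n) : ℝ) = (n + 1) * 2 ^ n - 1 := by
  rw [card_hornClause, Nat.cast_sub (by have := Nat.one_le_two_pow (n := n); nlinarith)]
  push_cast
  ring

theorem mul_two_pow_le_card (n : ℕ) : (n : ℝ) * 2 ^ n ≤ Fintype.card (HornClause n) := by
  rw [card_hornClause_real]
  have : (1 : ℝ) ≤ 2 ^ n := one_le_pow₀ (by norm_num)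
  linarith

theorem card_le_two_mul (hn : 1 ≤ n) :
    (Fintype.card (HornClause n) : ℝ) ≤ 2 * n * 2 ^ n := by
  rw [card_hornClause_real]
  have : (1 : ℝ) ≤ n := by exact_mod_cast hn
  have : (0 : ℝ) < 2 ^ n := by positivity
  nlinarith

theorem card_pos_real (hn : 1 ≤ n) : (0 : ℝ) < Fintype.card (HornClause n) :=
  lt_of_lt_of_le (by positivity) (mul_two_pow_le_card n)

theorem mul_div_card_le (hn : 1 ≤ n) (hm : (m : ℝ) ≤ c * 2 ^ n) :
    (n * m : ℝ) / Fintype.card (HornClause n) ≤ c := by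
  rw [div_le_iff₀ (card_pos_real hn)]
  have h1 := mul_two_pow_le_card n
  have hc : 0 ≤ c := by
    by_contra! h
    have : c * 2 ^ n < 0 := mul_neg_of_neg_of_pos h (by positivity)
    have : (0 : ℝ) ≤ m := by positivity
    linarith
  calc (n * m : ℝ) ≤ n * (c * 2 ^ n) := by gcongr
    _ = c * (n * 2 ^ n) := by ring
    _ ≤ _ := by gcongr

/-- The bound for the probability that propagation stops after exactly `i` steps. -/
def stopBound (c : ℝ) (i : ℕ) : ℝ := c ^ i * 2 ^ (i * i) * Real.exp (-(c / 8 * 2 ^ i))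

theorem avg_reach_sub_le (hc : 0 ≤ c) (hn : 1 ≤ n) (hm : (m : ℝ) ≤ c * 2 ^ n)
    (hm' : c * 2 ^ n / 2 ≤ (m : ℝ) - n) {i : ℕ} (hi : 2 * i ≤ n) :
    avg (fun f : Fin m → HornClause n => reach (toFormula f) i) -
      avg (fun f : Fin m → HornClause n => reach (toFormula f) (i + 1)) ≤ stopBound c i := by
  have hH := card_pos_real hn
  have him : i ≤ m := by
    have h1 : (0 : ℝ) ≤ c * 2 ^ n / 2 := by positivity
    have : (n : ℝ) ≤ m := by linarith
    have : n ≤ m := by exact_mod_cast this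
    omega
  have hin : (2 * i : ℝ) ≤ n := by exact_mod_cast hi
  rw [← avg_sub, avg]
  refine (div_le_div_of_nonneg_right (sum_reach_sub_le (by omega)) (by positivity)).trans ?_
  rw [← Nat.add_sub_cancel' him, Nat.add_sub_cancel_left, pow_add, stopBound, mul_div_mul_comm,
    mul_div_right_comm, ← div_pow, ← div_pow]
  have hle : (n - i : ℝ) * 2 ^ i ≤ Fintype.card (HornClause n) := by
    refine le_trans ?_ (mul_two_pow_le_card n)
    gcongr
    · linarith
    · norm_num
    · omega
  have h2 : ((Fintype.card (HornClause n) - (n - i) * 2 ^ i : ℝ) /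
      Fintype.card (HornClause n)) ^ (m - i) ≤ Real.exp (-(c / 8 * 2 ^ i)) := by
    set x : ℝ := (n - i) * 2 ^ i / Fintype.card (HornClause n) with hx
    have e : (Fintype.card (HornClause n) - (n - i) * 2 ^ i : ℝ) /
      Fintype.card (HornClause n) = 1 - x := by rw [sub_div, div_self hH.ne']
    rw [e]
    have hx1 : x ≤ 1 := (div_le_one hH).2 hle
    calc (1 - x) ^ (m - i) ≤ Real.exp (-x) ^ (m - i) := by
          have := Real.add_one_le_exp (-x)
          gcongr
          · linarith
      _ = Real.exp (-(x * (m - i))) := by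
          rw [← Real.exp_nat_mul, Nat.cast_sub him]
          congr 1; ring
      _ ≤ _ := by
          refine Real.exp_le_exp.2 (neg_le_neg ?_)
          have h3 : (n / 2 : ℝ) * (c * 2 ^ n / 2) ≤ (n - i) * (m - i) := by
            gcongr <;> linarith
          -- The constant 8 collects a factor 2 from each of `n - i ≥ n / 2`, `m - i ≥ c * 2^n / 2`
          -- and the bound `2 * n * 2^n` for the number of clauses.
          have h4 : c / 8 ≤ (n - i) * (m - i) / Fintype.card (HornClause n) := by
            rw [le_div_iff₀ hH]
            calc _ ≤ c / 8 * (2 * n * 2 ^ n) := by gcongr; exact card_le_two_mul hn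
              _ = (n / 2 : ℝ) * (c * 2 ^ n / 2) := by ring
              _ ≤ _ := h3
          calc c / 8 * 2 ^ i ≤ (n - i) * (m - i) / Fintype.card (HornClause n) * 2 ^ i := by
                gcongr
            _ = _ := by rw [hx]; ring
  have e3 : i + (m - i) = m := Nat.add_sub_cancel' him
  rw [e3]
  have h6 : (n * m / Fintype.card (HornClause n) : ℝ) ^ i ≤ c ^ i := by
    gcongr
    exact mul_div_card_le hn hm
  have h7 : 0 ≤ ((Fintype.card (HornClause n) - (n - i) * 2 ^ i : ℝ) /
      Fintype.card (HornClause n)) ^ (m - i) :=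
    pow_nonneg (div_nonneg (sub_nonneg.2 hle) hH.le) _
  calc _ = (n * m / Fintype.card (HornClause n) : ℝ) ^ i * 2 ^ (i * i) *
        ((Fintype.card (HornClause n) - (n - i) * 2 ^ i : ℝ) /
          Fintype.card (HornClause n)) ^ (m - i) := by ring
    _ ≤ _ := by gcongr

theorem avg_reach_sub_le_sum (hc : 0 ≤ c) (hn : 1 ≤ n) (hm : (m : ℝ) ≤ c * 2 ^ n)
    (hm' : c * 2 ^ n / 2 ≤ (m : ℝ) - n) {a b : ℕ} (hab : a ≤ b) (hb : 2 * b ≤ n) :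
    avg (fun f : Fin m → HornClause n => reach (toFormula f) a) -
      avg (fun f : Fin m → HornClause n => reach (toFormula f) b) ≤
      ∑ i ∈ Finset.Ico a b, stopBound c i := by
  induction b, hab using Nat.le_induction with
  | base => simp
  | succ b hab ih =>
    rw [Finset.sum_Ico_succ_top hab]
    have := ih (by omega)
    have := avg_reach_sub_le hc hn hm hm' (i := b) (by omega)
    linarith

/-- Bounds from below the probability of having exactly `a` positive unit clauses, on distinct
variables. The exponential pays for the absence of further ones. -/
theorem le_avg_reach (hc : 0 ≤ c) (hn : 1 ≤ n) (hm : (m : ℝ) ≤ c * 2 ^ n)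
    (hm' : c * 2 ^ n / 2 ≤ (m : ℝ) - n) {a : ℕ} (ha : 1 ≤ a) (han : 2 * a ≤ n) :
    (c / (8 * a)) ^ a * Real.exp (-(2 * c)) ≤
      avg fun f : Fin m → HornClause n => reach (toFormula f) a := by
  have hH := card_pos_real hn
  have ham : a ≤ m := by
    have h1 : (0 : ℝ) ≤ c * 2 ^ n / 2 := by positivity
    have : (n : ℝ) ≤ m := by linarith
    have : n ≤ m := by exact_mod_cast this
    omega
  have hin : (2 * a : ℝ) ≤ n := by exact_mod_cast han
  have ha0 : (0 : ℝ) < a := by exact_mod_cast ha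
  rw [avg, le_div_iff₀ (by positivity)]
  have key := le_sum_reach (n := n) (m := m) a
  have h1 : ((m - a : ℝ) * (n - a)) ^ a ≤ m.descFactorial a * n.descFactorial a := by
    have g : ∀ k : ℕ, a ≤ k → (k - a : ℝ) ^ a ≤ k.descFactorial a := fun k hk => by
      rw [← Nat.cast_sub hk]
      exact_mod_cast (Nat.pow_le_pow_left (by omega) a).trans (Nat.pow_sub_le_descFactorial k a)
    rw [mul_pow]
    have hm2 : (0 : ℝ) ≤ m - a := sub_nonneg.2 (by exact_mod_cast ham)
    have hn2 : (0 : ℝ) ≤ n - a := by linarith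
    gcongr
    · exact g m ham
    · exact g n (by omega)
  set H : ℝ := (Fintype.card (HornClause n) : ℝ)
  have h2 : c / (8 * a) * (a * H) ≤ (m - a : ℝ) * (n - a) := by
    calc c / (8 * a) * (a * H) = c / 8 * H := by field_simp
      _ ≤ c / 8 * (2 * n * 2 ^ n) := by gcongr; exact card_le_two_mul hn
      _ = (c * 2 ^ n / 2) * (n / 2 : ℝ) := by ring
      _ ≤ _ := by gcongr <;> linarith
  have hx : (n : ℝ) / H ≤ 1 / 2 := by
    rw [div_le_div_iff₀ hH (by norm_num)]
    have h3 := mul_two_pow_le_card n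
    have : (2 : ℝ) ≤ 2 ^ n := le_self_pow₀ (by norm_num) (by omega)
    have h5 : (n : ℝ) * 2 ≤ n * 2 ^ n := by gcongr
    linarith
  have hx0 : 0 ≤ (n : ℝ) / H := by positivity
  have h3 : Real.exp (-(2 * c)) * H ^ (m - a) ≤ (H - n) ^ (m - a) := by
    have e : H - n = (1 - n / H) * H := by field_simp
    rw [e, mul_pow]
    gcongr
    -- For `0 ≤ t ≤ 1/2` one has `1 / (1 - t) ≤ 1 + 2 * t ≤ exp (2 * t)`.
    have h4 : Real.exp (-(2 * (n / H))) ≤ 1 - n / H := by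
      rw [Real.exp_neg, inv_le_comm₀ (Real.exp_pos _) (by linarith)]
      refine le_trans ?_ (Real.add_one_le_exp _)
      rw [inv_le_iff_one_le_mul₀ (by linarith)]
      nlinarith
    calc Real.exp (-(2 * c)) ≤ Real.exp (-(2 * (n / H))) ^ m := by
          rw [← Real.exp_nat_mul]
          gcongr
          have := mul_div_card_le hn hm
          calc (m : ℝ) * -(2 * (n / H)) = -(2 * (n * m / H)) := by ring
            _ ≥ _ := by gcongr
      _ ≤ Real.exp (-(2 * (n / H))) ^ (m - a) :=
          pow_le_pow_of_le_one (Real.exp_pos _).le (by simpa using hx0) (Nat.sub_le m a)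
      _ ≤ _ := by gcongr
  have haa : (0 : ℝ) < (a : ℝ) ^ a := by positivity
  have h8 : 0 ≤ ((m - a : ℝ) * (n - a)) ^ a := pow_nonneg (le_trans (by positivity) h2) a
  refine le_of_mul_le_mul_left ?_ haa
  refine le_trans ?_ key
  calc (a : ℝ) ^ a * ((c / (8 * a)) ^ a * Real.exp (-(2 * c)) * H ^ m)
      = (c / (8 * a) * (a * H)) ^ a * (Real.exp (-(2 * c)) * H ^ (m - a)) := by
        rw [← Nat.add_sub_cancel' ham, Nat.add_sub_cancel_left, pow_add]
        ring
    _ ≤ ((m - a : ℝ) * (n - a)) ^ a * (H - n) ^ (m - a) := by gcongr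
    _ ≤ _ := by
        gcongr
        exact pow_nonneg (by
          have : (n : ℝ) ≤ H := by
            rw [div_le_iff₀ hH] at hx
            linarith
          linarith) _

end bounds

end

/-! ### Rejection probabilities for finite `n`. -/

section

variable {n m : ℕ} {c : ℝ}

/-- The probability that PUR rejects after exactly `i` iterations. -/
def rejectProb (n m i : ℕ) : ℝ :=
  avg fun f : Fin m → HornClause n => (PUR (toFormula f) (false, i)).toReal

/-- The probability that propagation, disregarding rejections, makes at least `i` steps. -/
def reachProb (n m i : ℕ) : ℝ := avg fun f : Fin m → HornClause n => reach (toFormula f) i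

/-- The probability that no purely negative clause lies below a fixed set of `i` variables. -/
def avoidProb (n m i : ℕ) : ℝ := (1 - (2 ^ i - 1) / Fintype.card (HornClause n)) ^ m

/-- The probability that PUR rejects. -/
def unsatProb (n m : ℕ) : ℝ := ∑ i ∈ Finset.range n, rejectProb n m i

theorem nonempty_hornClause (hn : 1 ≤ n) : Nonempty (HornClause n) :=
  haveI : NeZero n := ⟨by omega⟩
  inferInstance

theorem avoidProb_eq_avg (hn : 1 ≤ n) (i : ℕ) :
    avoidProb n m i = avg fun f : Fin m → HornClause n => negWeight i f := by
  have := nonempty_hornClause hn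
  rw [avg_negWeight hn, avoidProb]

theorem rejectProb_le_avoidProb {i : ℕ} (hi : i < n) : rejectProb n m i ≤ avoidProb n m i := by
  rw [rejectProb, avg_PUR_false (by omega), avoidProb_eq_avg (by omega)]
  refine avg_mono fun f => ?_
  have h1 := negWeight_succ_le (by omega) hi f
  have h2 := negWeight_nonneg (by omega) hi f
  calc _ ≤ negWeight i f - negWeight (i + 1) f :=
        mul_le_of_le_one_left (by linarith) (reach_le_one _ _)
    _ ≤ _ := by linarith

theorem rejectProb_le_one_sub_avoidProb {i : ℕ} (hi : i < n) :
    rejectProb n m i ≤ 1 - avoidProb n m (i + 1) := by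
  have := nonempty_hornClause (n := n) (by omega)
  rw [rejectProb, avg_PUR_false (by omega), avoidProb_eq_avg (by omega),
    ← avg_const (α := HornClause n) (m := m) 1, ← avg_sub]
  refine avg_mono fun f => ?_
  have h1 := negWeight_succ_le (by omega) hi f
  have h2 := negWeight_le_one (i := i) (by omega) hi.le f
  calc _ ≤ negWeight i f - negWeight (i + 1) f :=
        mul_le_of_le_one_left (by linarith) (reach_le_one _ _)
    _ ≤ _ := by linarith

theorem rejectProb_nonneg (n m i : ℕ) : 0 ≤ rejectProb n m i :=
  avg_nonneg fun _ => ENNReal.toReal_nonneg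

theorem rejectProb_eq_zero {i : ℕ} (h : n ≤ i) : rejectProb n m i = 0 := by
  simp [rejectProb, PUR_false_eq_zero _ h, avg]

/-- Up to step `b` every factor `reach (i + 1)` is at least `reach b`, and the differences of
`negWeight` telescope. -/
theorem reachProb_sub_avoidProb_le {b : ℕ} (hn : 1 ≤ n) (hb : b ≤ n) :
    reachProb n m b - avoidProb n m b ≤ unsatProb n m := by
  have h1 : ∑ i ∈ Finset.range b, rejectProb n m i ≤ unsatProb n m :=
    Finset.sum_le_sum_of_subset_of_nonneg (Finset.range_subset_range.2 hb)
      fun i _ _ => rejectProb_nonneg n m i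
  refine le_trans ?_ h1
  simp only [rejectProb, avg_PUR_false hn]
  rw [← avg_sum, reachProb, avoidProb_eq_avg hn, ← avg_sub]
  refine avg_mono fun f => ?_
  calc reach (toFormula f) b - negWeight b f
      ≤ reach (toFormula f) b * (negWeight 0 f - negWeight b f) := by
        rw [negWeight_zero]
        nlinarith [reach_le_one (toFormula f) b, negWeight_nonneg hn hb f]
    _ = ∑ i ∈ Finset.range b,
        reach (toFormula f) b * (negWeight i f - negWeight (i + 1) f) := by
        rw [← Finset.mul_sum, Finset.sum_range_sub' fun i => negWeight i f]
    _ ≤ _ := Finset.sum_le_sum fun i hi => by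
        rw [Finset.mem_range] at hi
        have := negWeight_succ_le hn (by omega : i + 1 ≤ n) f
        exact mul_le_mul_of_nonneg_right (reach_antitone _ hi) (by linarith)

/-- The telescoping sum is cut at `a`: `reach` is bounded by 1 before the cut and by `reach a` after
it. -/
theorem unsatProb_le {a : ℕ} (hn : 1 ≤ n) (ha : a ≤ n) :
    unsatProb n m ≤ reachProb n m a + (1 - avoidProb n m a) := by
  have := nonempty_hornClause hn
  simp only [unsatProb, rejectProb, avg_PUR_false hn]
  rw [← avg_sum, reachProb, avoidProb_eq_avg hn, ← avg_const (α := HornClause n) (m := m) 1,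
    ← avg_sub, ← avg_add]
  refine avg_mono fun f => ?_
  have key : ∀ k, a ≤ k → k ≤ n → ∑ i ∈ Finset.range k,
      reach (toFormula f) (i + 1) * (negWeight i f - negWeight (i + 1) f) ≤
      reach (toFormula f) a * (negWeight a f - negWeight k f) + (1 - negWeight a f) := by
    intro k hk
    induction k, hk using Nat.le_induction with
    | base =>
      intro _
      rw [sub_self, mul_zero, zero_add, ← negWeight_zero f,
        ← Finset.sum_range_sub' fun i => negWeight i f]
      refine Finset.sum_le_sum fun i hi => ?_
      rw [Finset.mem_range] at hi
      have := negWeight_succ_le hn (by omega : i + 1 ≤ n) f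
      exact mul_le_of_le_one_left (by linarith) (reach_le_one _ _)
    | succ k hk ih =>
      intro hkn
      rw [Finset.sum_range_succ]
      have h1 := ih (by omega)
      have h2 := negWeight_succ_le hn hkn f
      have h3 : reach (toFormula f) (k + 1) * (negWeight k f - negWeight (k + 1) f) ≤
          reach (toFormula f) a * (negWeight k f - negWeight (k + 1) f) :=
        mul_le_mul_of_nonneg_right (reach_antitone _ (by omega)) (by linarith)
      linarith
  refine (key n ha le_rfl).trans ?_
  have h1 := negWeight_le_one hn ha f
  have h2 := negWeight_nonneg hn le_rfl f
  have h3 := reach_nonneg (toFormula f) a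
  nlinarith

theorem pow_sub_pow_le_mul {x y : ℝ} (hy : 0 ≤ y) (hyx : y ≤ x) (hx : x ≤ 1) (m : ℕ) :
    x ^ m - y ^ m ≤ m * (x - y) := by
  induction m with
  | zero => simp
  | succ m ih =>
    have h1 : y ^ m ≤ 1 := pow_le_one₀ hy (hyx.trans hx)
    have h2 : 0 ≤ x - y := by linarith
    have h4 : y ^ m ≤ x ^ m := by gcongr
    calc x ^ (m + 1) - y ^ (m + 1) = x * (x ^ m - y ^ m) + y ^ m * (x - y) := by ring
      _ ≤ 1 * (x ^ m - y ^ m) + 1 * (x - y) := by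
          gcongr
      _ ≤ _ := by push_cast; linarith

/-- Both moments are `m`-th powers, and their bases differ by less than `(2^i)^2 / ((2^n - 1) *
card)`. `pow_sub_pow_le_mul` costs only a factor `m`, so the result is exponentially small when `2^i
= O(n)`. -/
theorem variance_negWeight_le {i : ℕ} (hn : 1 ≤ n) (hi : i ≤ n) (hm : (m : ℝ) ≤ c * 2 ^ n) :
    avg (fun f : Fin m → HornClause n => negWeight i f ^ 2) -
      avg (fun f : Fin m → HornClause n => negWeight i f) ^ 2 ≤
      c * ((2 ^ i) ^ 2 / (n * (2 ^ n - 1))) := by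
  have := nonempty_hornClause hn
  have hH := card_pos_real hn
  have hp := two_pow_sub_one_pos hn
  rw [avg_negWeight_sq hn, avg_negWeight hn, ← pow_mul, mul_comm m 2, pow_mul]
  set H : ℝ := (Fintype.card (HornClause n) : ℝ)
  set P : ℝ := 2 ^ i - 1 with hP
  have hP0 : 0 ≤ P := sub_nonneg.2 (one_le_pow₀ (by norm_num))
  have hPn : P ≤ 2 ^ n - 1 := by
    rw [hP]
    gcongr
    norm_num
  have hPi : P ≤ 2 ^ i := by linarith
  have hnH : (2 : ℝ) ^ n - 1 ≤ H := by
    have := mul_two_pow_le_card n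
    have h1 : (1 : ℝ) ≤ n := by exact_mod_cast hn
    have h2 : (0 : ℝ) < 2 ^ n := by positivity
    have h3 : (1 : ℝ) * 2 ^ n ≤ n * 2 ^ n := by gcongr
    linarith
  have h1 : P ^ 2 / H ^ 2 ≤ P ^ 2 / ((2 ^ n - 1) * H) := by
    rw [pow_two H]
    gcongr
  have h2 : P ^ 2 / ((2 ^ n - 1) * H) ≤ P / H := by
    rw [div_le_div_iff₀ (by positivity) hH]
    have : P * P * H ≤ P * (2 ^ n - 1) * H := by gcongr
    linarith
  have h3 : 0 ≤ P / H := by positivity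
  have h4 : (1 - P / H) ^ 2 = 1 - 2 * (P / H) + P ^ 2 / H ^ 2 := by
    rw [← div_pow]; ring
  refine (pow_sub_pow_le_mul (sq_nonneg _) ?_ ?_ m).trans ?_
  · linarith
  · linarith
  · calc _ ≤ (m : ℝ) * (P ^ 2 / ((2 ^ n - 1) * H)) := by
          gcongr
          have : 0 ≤ P ^ 2 / H ^ 2 := by positivity
          nlinarith [sq_nonneg (1 - P / H)]
      _ = (m / H) * (P ^ 2 / (2 ^ n - 1)) := by field_simp
      _ ≤ (c / n) * ((2 ^ i) ^ 2 / (2 ^ n - 1)) := by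
          have hn0 : (0 : ℝ) < n := by exact_mod_cast hn
          have h5 : (n * m : ℝ) / H ≤ c := mul_div_card_le hn hm
          have h6 : 0 ≤ c := le_trans (by positivity) h5
          have h7 : m / H ≤ c / n := by
            rw [le_div_iff₀ hn0]
            exact le_trans (by ring_nf; rfl) h5
          gcongr
      _ = _ := by
          have hn0 : (n : ℝ) ≠ 0 := by positivity
          field_simp

theorem abs_rejectProb_sub_le {i : ℕ} (hi : i < n) (hm : (m : ℝ) ≤ c * 2 ^ n) :
    |rejectProb n m i - reachProb n m (i + 1) * (avoidProb n m i - avoidProb n m (i + 1))| ≤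
      √(c * ((2 ^ i) ^ 2 / (n * (2 ^ n - 1)))) +
        √(c * ((2 ^ (i + 1)) ^ 2 / (n * (2 ^ n - 1)))) := by
  have hn : 1 ≤ n := by omega
  have := nonempty_hornClause hn
  have h : ∀ j, j ≤ n → |avg (fun f : Fin m → HornClause n =>
      reach (toFormula f) (i + 1) * negWeight j f) -
      reachProb n m (i + 1) * avoidProb n m j| ≤
      √(c * ((2 ^ j) ^ 2 / (n * (2 ^ n - 1)))) := fun j hj => by
    rw [avoidProb_eq_avg hn, reachProb]
    exact (abs_avg_mul_sub_le (fun f => reach_nonneg _ _) fun f => reach_le_one _ _).trans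
      (Real.sqrt_le_sqrt (variance_negWeight_le hn hj hm))
  rw [rejectProb, avg_PUR_false hn]
  have e : avg (fun f : Fin m → HornClause n =>
      reach (toFormula f) (i + 1) * (negWeight i f - negWeight (i + 1) f)) =
      avg (fun f : Fin m → HornClause n => reach (toFormula f) (i + 1) * negWeight i f) -
      avg fun f : Fin m → HornClause n => reach (toFormula f) (i + 1) * negWeight (i + 1) f := by
    rw [← avg_sub]
    congr 1
    ext f
    ring
  rw [e]
  refine le_trans (le_of_eq ?_) ((abs_sub _ _).trans (add_le_add (h i hi.le) (h (i + 1) hi)))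
  congr 1
  ring

theorem reachProb_antitone (n m : ℕ) : Antitone (reachProb n m) :=
  fun _ _ h => avg_mono fun f => reach_antitone (toFormula f) h

/-! ### Exponential estimates for `avoidProb`. -/

section avoid

variable {i : ℕ}

theorem avoidRatio_nonneg : (0 : ℝ) ≤ (2 ^ i - 1) / Fintype.card (HornClause n) :=
  div_nonneg (sub_nonneg.2 (one_le_pow₀ (by norm_num))) (Nat.cast_nonneg _)

theorem avoidRatio_le (hn : 1 ≤ n) :
    (2 ^ i - 1) / Fintype.card (HornClause n) ≤ (2 : ℝ) ^ i / (n * 2 ^ n) := by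
  have hn0 : (0 : ℝ) < n := by exact_mod_cast hn
  gcongr
  · linarith
  · exact mul_two_pow_le_card n

theorem avoidRatio_le_one (hn : 1 ≤ n) (hi : i ≤ n) :
    (2 ^ i - 1) / Fintype.card (HornClause n) ≤ (1 : ℝ) := by
  refine (avoidRatio_le hn).trans ?_
  have hn0 : (1 : ℝ) ≤ n := by exact_mod_cast hn
  rw [div_le_one (by positivity)]
  calc (2 : ℝ) ^ i ≤ 1 * 2 ^ n := by
        rw [one_mul]
        gcongr
        norm_num
    _ ≤ _ := by gcongr

theorem one_sub_avoidProb_le (hn : 1 ≤ n) (hi : i ≤ n) (hm : (m : ℝ) ≤ c * 2 ^ n) :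
    1 - avoidProb n m i ≤ c * (2 ^ i / n) := by
  have h1 := one_add_mul_le_pow (a := -((2 ^ i - 1) / Fintype.card (HornClause n) : ℝ))
    (by linarith [avoidRatio_le_one hn hi]) m
  rw [← sub_eq_add_neg, ← avoidProb] at h1
  have hn0 : (0 : ℝ) < n := by exact_mod_cast hn
  have hH := card_pos_real hn
  have h2 := mul_div_card_le hn hm
  have h3 : (m : ℝ) * ((2 ^ i - 1) / Fintype.card (HornClause n)) ≤ c * (2 ^ i / n) := by
    calc _ = (n * m / Fintype.card (HornClause n)) * ((2 ^ i - 1) / n : ℝ) := by field_simp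
      _ ≤ (n * m / Fintype.card (HornClause n)) * (2 ^ i / n : ℝ) := by
          gcongr
          linarith
      _ ≤ _ := by gcongr
  linarith

theorem avoidProb_le_exp (hn : 1 ≤ n) (hi : i ≤ n) :
    avoidProb n m i ≤
      Real.exp (-(n * m / Fintype.card (HornClause n) * ((2 ^ i - 1) / n))) := by
  have hn0 : (0 : ℝ) < n := by exact_mod_cast hn
  have h1 := avoidRatio_le_one hn hi
  have h2 := Real.add_one_le_exp (-((2 ^ i - 1) / Fintype.card (HornClause n) : ℝ))
  calc avoidProb n m i ≤ Real.exp (-((2 ^ i - 1) / Fintype.card (HornClause n) : ℝ)) ^ m := by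
        rw [avoidProb]
        gcongr
        · linarith
    _ = _ := by
        rw [← Real.exp_nat_mul]
        congr 1
        field_simp

theorem avoidProb_le_exp' (hn : 1 ≤ n) (hi : i ≤ n) (hc : 0 ≤ c)
    (hm' : c * 2 ^ n / 2 ≤ (m : ℝ)) :
    avoidProb n m i ≤ Real.exp (-(c / 4 * ((2 ^ i - 1) / n))) := by
  refine (avoidProb_le_exp hn hi).trans (Real.exp_le_exp.2 (neg_le_neg ?_))
  have hn0 : (0 : ℝ) < n := by exact_mod_cast hn
  have h0 : (0 : ℝ) ≤ (2 ^ i - 1) / n :=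
    div_nonneg (sub_nonneg.2 (one_le_pow₀ (by norm_num))) hn0.le
  have hH := card_pos_real hn
  refine mul_le_mul_of_nonneg_right ?_ h0
  rw [le_div_iff₀ hH]
  calc _ ≤ c / 4 * (2 * n * 2 ^ n) := by gcongr; exact card_le_two_mul hn
    _ = n * (c * 2 ^ n / 2) := by ring
    _ ≤ _ := by gcongr

theorem exp_le_avoidProb (hn : 1 ≤ n)
    (hi : (2 ^ i - 1) / Fintype.card (HornClause n) ≤ (1 / 2 : ℝ)) :
    Real.exp (-(n * m / Fintype.card (HornClause n) * ((2 ^ i - 1) / n) *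
      (1 + 2 * ((2 ^ i - 1) / Fintype.card (HornClause n))))) ≤ avoidProb n m i := by
  have hn0 : (0 : ℝ) < n := by exact_mod_cast hn
  have h0 := avoidRatio_nonneg (n := n) (i := i)
  set y : ℝ := (2 ^ i - 1) / Fintype.card (HornClause n) with hy
  have h1 : Real.exp (-(y * (1 + 2 * y))) ≤ 1 - y := by
    rw [Real.exp_neg, inv_le_comm₀ (Real.exp_pos _) (by linarith)]
    refine le_trans ?_ (Real.add_one_le_exp _)
    rw [inv_le_iff_one_le_mul₀ (by linarith)]
    nlinarith [mul_nonneg h0 h0]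
  calc _ = Real.exp (-(y * (1 + 2 * y))) ^ m := by
        rw [← Real.exp_nat_mul]
        congr 1
        rw [hy]
        field_simp
    _ ≤ _ := by
        rw [avoidProb, ← hy]
        gcongr

theorem avoidProb_nonneg (hn : 1 ≤ n) (hi : i ≤ n) : 0 ≤ avoidProb n m i :=
  pow_nonneg (sub_nonneg.2 (avoidRatio_le_one hn hi)) _

theorem avoidProb_le_one (hn : 1 ≤ n) (hi : i ≤ n) : avoidProb n m i ≤ 1 :=
  pow_le_one₀ (sub_nonneg.2 (avoidRatio_le_one hn hi))
    (by linarith [avoidRatio_nonneg (n := n) (i := i)])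

theorem avoidProb_succ_le (hn : 1 ≤ n) (hi : i + 1 ≤ n) :
    avoidProb n m (i + 1) ≤ avoidProb n m i := by
  rw [avoidProb_eq_avg hn, avoidProb_eq_avg hn]
  exact avg_mono fun f => negWeight_succ_le hn hi f

end avoid

end

/-! ### Asymptotics of the reach, avoidance and rejection probabilities. -/

section

variable {c : ℝ}

theorem G_eq (k : ℤ) (c : ℝ) : G k c = Real.exp (-(c * 2 ^ (k + 1))) := by
  let e : ℕ ≃ Set.Iic k :=
    { toFun := fun i => ⟨k - i, by simp⟩
      invFun := fun j => (k - j).toNat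
      left_inv := fun i => by simp
      right_inv := fun j => by
        have := j.2
        rw [Set.mem_Iic] at this
        ext
        simp only
        omega }
  have h : ∑' j : Set.Iic k, (2 : ℝ) ^ (j : ℤ) = 2 ^ (k + 1) := by
    rw [← e.tsum_eq]
    have : ∀ i : ℕ, (2 : ℝ) ^ ((e i : ℤ)) = 2 ^ k * (1 / 2) ^ i := fun i => by
      change (2 : ℝ) ^ (k - (i : ℤ)) = _
      rw [zpow_sub₀ (by norm_num), zpow_natCast, one_div, inv_pow]
      rfl
    simp only [this]
    rw [tsum_mul_left, tsum_geometric_two, zpow_add₀ (by norm_num), zpow_one]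
  rw [G, h]
  ring_nf

theorem iterProbUnsat_natCast {n : ℕ} (hn : 1 ≤ n) (c : ℝ) (i : ℕ) :
    iterProbUnsat c n i = rejectProb n ⌊c * 2 ^ n⌋₊ i / unsatProb n ⌊c * 2 ^ n⌋₊ := by
  have : NeZero n := ⟨by omega⟩
  rw [iterProbUnsat, dif_neg (by omega)]
  simp only [condProb]
  rw [prob_iterations_inter_unsat, prob_unsat]
  rfl

theorem iterProbUnsat_of_neg (c : ℝ) (n : ℕ) {i : ℤ} (hi : i < 0) : iterProbUnsat c n i = 0 := by
  rw [iterProbUnsat]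
  split_ifs with h
  · rfl
  · have e : ({ω | (ω.2 : ℤ) = i} ∩ {ω | ¬ ω.1.Satisfiable} : Set (Formula n × ℕ)) = ∅ := by
      ext ω
      simp only [Set.mem_inter_iff, Set.mem_ofPred_eq, Set.mem_empty_iff_false, iff_false, not_and]
      omega
    simp [condProb, e, prob]

theorem tendsto_natCast_div_two_pow :
    Tendsto (fun n : ℕ => (n : ℝ) / 2 ^ n) atTop (𝓝 0) := by
  simpa using tendsto_pow_const_div_const_pow_of_one_lt 1 (r := (2 : ℝ)) (by norm_num)

theorem eventually_floor_bounds (hc : 0 < c) :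
    ∀ᶠ n : ℕ in atTop, 1 ≤ n ∧ (⌊c * 2 ^ n⌋₊ : ℝ) ≤ c * 2 ^ n ∧
      c * 2 ^ n / 2 ≤ (⌊c * 2 ^ n⌋₊ : ℝ) - n := by
  filter_upwards [eventually_ge_atTop 1,
    tendsto_natCast_div_two_pow.eventually (ge_mem_nhds (show 0 < c / 4 by positivity))]
    with n hn h
  refine ⟨hn, Nat.floor_le (by positivity), ?_⟩
  have h1 := Nat.lt_floor_add_one (c * 2 ^ n)
  rw [div_le_iff₀ (by positivity)] at h
  have : (1 : ℝ) ≤ n := by exact_mod_cast hn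
  linarith

theorem tendsto_mul_div_card (hc : 0 < c) :
    Tendsto (fun n : ℕ => (n * ⌊c * 2 ^ n⌋₊ : ℝ) / Fintype.card (HornClause n)) atTop (𝓝 c) := by
  have h1 : Tendsto (fun n : ℕ => (⌊c * 2 ^ n⌋₊ : ℝ) / 2 ^ n) atTop (𝓝 c) :=
    (tendsto_nat_floor_mul_div_atTop hc.le).comp
      (tendsto_pow_atTop_atTop_of_one_lt (r := (2 : ℝ)) (by norm_num))
  have h2 : Tendsto (fun n : ℕ => (1 : ℝ) + (n : ℝ)⁻¹) atTop (𝓝 (1 + 0)) :=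
    tendsto_const_nhds.add tendsto_inv_atTop_nhds_zero_nat
  have h3 : Tendsto (fun n : ℕ => (⌊c * 2 ^ n⌋₊ : ℝ) / 2 ^ n / (1 + (n : ℝ)⁻¹)) atTop (𝓝 c) := by
    have h := h1.div h2 (by norm_num)
    simp only [add_zero, div_one] at h
    exact h
  refine tendsto_of_tendsto_of_tendsto_of_le_of_le' h3 tendsto_const_nhds ?_ ?_
  · filter_upwards [eventually_ge_atTop 1] with n hn
    have hn0 : (0 : ℝ) < n := by exact_mod_cast hn
    have e : (⌊c * 2 ^ n⌋₊ : ℝ) / 2 ^ n / (1 + (n : ℝ)⁻¹) =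
        (n * ⌊c * 2 ^ n⌋₊ : ℝ) / ((n + 1) * 2 ^ n) := by
      field_simp
    rw [e]
    have := card_pos_real hn
    gcongr
    rw [card_hornClause_real]
    linarith
  · filter_upwards [eventually_floor_bounds hc] with n hn
    exact mul_div_card_le hn.1 hn.2.1

theorem tendsto_two_pow_half_sub_one_div :
    Tendsto (fun n : ℕ => ((2 : ℝ) ^ (n / 2) - 1) / n) atTop atTop := by
  refine tendsto_atTop.2 fun M => ?_
  have h := tendsto_pow_const_div_const_pow_of_one_lt 2 (r := (2 : ℝ)) (by norm_num)
  -- The factor 2 compensates for rounding in `n / 2`, since `2^n ≤ 2 * (2^(n/2))^2`. Taking `|M| +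
  -- 1` leaves room for the subtracted 1.
  have hM : 0 < 1 / (2 * (|M| + 1) ^ 2) := by positivity
  filter_upwards [eventually_ge_atTop 1, h.eventually (ge_mem_nhds hM)] with n hn h1
  have hn0 : (1 : ℝ) ≤ n := by exact_mod_cast hn
  rw [le_div_iff₀ (by linarith), le_sub_iff_add_le]
  rw [div_le_div_iff₀ (by positivity) (by positivity), one_mul] at h1
  have h2 : ((|M| + 1) * n) ^ 2 ≤ ((2 : ℝ) ^ (n / 2)) ^ 2 := by
    have h3 : (2 : ℝ) ^ n ≤ 2 * ((2 : ℝ) ^ (n / 2)) ^ 2 := by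
      rw [← pow_mul, ← pow_succ']
      gcongr
      · norm_num
      · omega
    nlinarith
  have h4 := le_of_sq_le_sq h2 (by positivity)
  have h5 : M * n ≤ |M| * n := by gcongr; exact le_abs_self M
  nlinarith

theorem tendsto_avoidProb_half (hc : 0 < c) :
    Tendsto (fun n : ℕ => avoidProb n ⌊c * 2 ^ n⌋₊ (n / 2)) atTop (𝓝 0) := by
  have h : Tendsto (fun n : ℕ => Real.exp (-(c / 4 * (((2 : ℝ) ^ (n / 2) - 1) / n)))) atTop
      (𝓝 0) :=
    Real.tendsto_exp_neg_atTop_nhds_zero.comp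
      (tendsto_two_pow_half_sub_one_div.const_mul_atTop (by positivity))
  refine tendsto_of_tendsto_of_tendsto_of_le_of_le' tendsto_const_nhds h ?_ ?_
  · filter_upwards [eventually_ge_atTop 1] with n hn
    exact avoidProb_nonneg hn (by omega)
  · filter_upwards [eventually_floor_bounds hc] with n hn
    refine avoidProb_le_exp' hn.1 (by omega) hc.le ?_
    have : (0 : ℝ) ≤ n := by positivity
    linarith [hn.2.2]

theorem stopBound_nonneg (hc : 0 < c) (i : ℕ) : 0 ≤ stopBound c i := by
  unfold stopBound; positivity

/-- On the logarithmic scale `c^i * 2^(i*i)` contributes only `O(i^2)`, while the exponential factor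
contributes `-(c/8) * 2^i`. -/
theorem eventually_stopBound_le (hc : 0 < c) :
    ∀ᶠ i : ℕ in atTop, stopBound c i ≤ Real.exp (-((i : ℝ) ^ 2)) := by
  have h := tendsto_pow_const_div_const_pow_of_one_lt 2 (r := (2 : ℝ)) (by norm_num)
  have hK : 0 < c / 8 / (|Real.log c| + 2) := by positivity
  filter_upwards [eventually_ge_atTop 1, h.eventually (ge_mem_nhds hK)] with i hi h1
  have hi0 : (1 : ℝ) ≤ i := by exact_mod_cast hi
  rw [div_le_div_iff₀ (by positivity) (by positivity)] at h1
  have e1 : c ^ i = Real.exp (i * Real.log c) := by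
    rw [Real.exp_nat_mul, Real.exp_log hc]
  have e2 : (2 : ℝ) ^ (i * i) = Real.exp ((i : ℝ) ^ 2 * Real.log 2) := by
    rw [pow_two, ← Nat.cast_mul, Real.exp_nat_mul, Real.exp_log (by norm_num)]
  rw [stopBound, e1, e2, ← Real.exp_add, ← Real.exp_add]
  refine Real.exp_le_exp.2 ?_
  have h2 : i * Real.log c ≤ (i : ℝ) ^ 2 * |Real.log c| := by
    have h3 : (i : ℝ) * Real.log c ≤ i * |Real.log c| := by gcongr; exact le_abs_self _
    have h4 : (i : ℝ) * |Real.log c| ≤ i ^ 2 * |Real.log c| := by gcongr; nlinarith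
    linarith
  have h5 : (i : ℝ) ^ 2 * Real.log 2 ≤ i ^ 2 * 1 := by
    gcongr
    linarith [Real.log_two_lt_d9]
  linarith

theorem exp_neg_sq_add_le (a j : ℕ) (ha : 1 ≤ a) :
    Real.exp (-(((j + a : ℕ) : ℝ) ^ 2)) ≤ Real.exp (-(a : ℝ) ^ 2) * Real.exp (-(j : ℝ)) := by
  rw [← Real.exp_add]
  refine Real.exp_le_exp.2 ?_
  have h1 : (1 : ℝ) ≤ a := by exact_mod_cast ha
  have h2 : (0 : ℝ) ≤ j := by positivity
  push_cast
  nlinarith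

theorem summable_stopBound (hc : 0 < c) : Summable (stopBound c) := by
  obtain ⟨a, ha⟩ := eventually_atTop.1 (eventually_stopBound_le hc)
  rw [← summable_nat_add_iff (a + 1)]
  refine Summable.of_nonneg_of_le (fun j => stopBound_nonneg hc _) (fun j => ?_)
    (Real.summable_exp_neg_nat.mul_left (Real.exp (-((a + 1 : ℕ) : ℝ) ^ 2)))
  exact (ha _ (by omega)).trans (exp_neg_sq_add_le _ _ (by omega))

theorem sum_stopBound_le (hc : 0 < c) (a b : ℕ) :
    ∑ i ∈ Finset.Ico a b, stopBound c i ≤ ∑' j, stopBound c (j + a) := by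
  rw [Finset.sum_Ico_eq_sum_range]
  simp only [add_comm a]
  exact ((summable_nat_add_iff a).2 (summable_stopBound hc)).sum_le_tsum _
    fun j _ => stopBound_nonneg hc _

/-- The tail is `O(exp (-a^2))`, whereas the right-hand side is only of order `exp (-a * log a +
O(a))`. -/
theorem exists_tsum_stopBound_lt (hc : 0 < c) :
    ∃ a : ℕ, 1 ≤ a ∧
      ∑' j, stopBound c (j + a) < (c / (8 * a)) ^ a * Real.exp (-(2 * c)) := by
  set S := ∑' j : ℕ, Real.exp (-(j : ℝ)) with hS
  have h1 : Tendsto (fun a : ℕ => c / 8 * (Real.exp (a : ℝ) / (a : ℝ))) atTop atTop := by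
    have := (Real.tendsto_exp_div_pow_atTop 1).comp tendsto_natCast_atTop_atTop
    simp only [pow_one] at this
    exact this.const_mul_atTop (by positivity)
  -- The maximum with 1 makes the base at least 1, so that its `a`-th power is no smaller than the
  -- base itself.
  obtain ⟨a, ha1, ha2, ha3⟩ := ((eventually_ge_atTop 1).and
    ((eventually_forall_ge_atTop.2 (eventually_stopBound_le hc)).and
      (h1.eventually_ge_atTop (max 1 (S * Real.exp (2 * c) + 1))))).exists
  refine ⟨a, ha1, ?_⟩
  have ha0 : (0 : ℝ) < a := by exact_mod_cast ha1
  have h2 : ∑' j, stopBound c (j + a) ≤ Real.exp (-(a : ℝ) ^ 2) * S := by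
    rw [hS, ← tsum_mul_left]
    refine ((summable_nat_add_iff a).2 (summable_stopBound hc)).tsum_le_tsum (fun j => ?_)
      (Real.summable_exp_neg_nat.mul_left _)
    exact (ha2 _ (by omega)).trans (exp_neg_sq_add_le _ _ ha1)
  refine lt_of_le_of_lt h2 ?_
  have h3 : S * Real.exp (2 * c) < (c / 8 * (Real.exp (a : ℝ) / (a : ℝ))) ^ a := by
    have h4 : 1 ≤ c / 8 * (Real.exp (a : ℝ) / (a : ℝ)) := (le_max_left _ _).trans ha3
    have h5 := le_self_pow₀ h4 (by omega : a ≠ 0)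
    have h6 := (le_max_right _ _).trans ha3
    linarith
  have e1 : (c / 8 * (Real.exp (a : ℝ) / (a : ℝ))) ^ a =
      (c / (8 * a)) ^ a * Real.exp ((a : ℝ) ^ 2) := by
    rw [pow_two, Real.exp_nat_mul, ← mul_pow]
    congr 1
    field_simp
  rw [e1] at h3
  have h7 := mul_lt_mul_of_pos_right h3
    (mul_pos (Real.exp_pos (-(a : ℝ) ^ 2)) (Real.exp_pos (-(2 * c))))
  have e2 : Real.exp (2 * c) * Real.exp (-(2 * c)) = 1 := by
    rw [← Real.exp_add]; simp
  have e3 : Real.exp ((a : ℝ) ^ 2) * Real.exp (-(a : ℝ) ^ 2) = 1 := by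
    rw [← Real.exp_add]; simp
  calc Real.exp (-(a : ℝ) ^ 2) * S
      = S * (Real.exp (2 * c) * Real.exp (-(2 * c))) * Real.exp (-(a : ℝ) ^ 2) := by
        rw [e2]; ring
    _ = S * Real.exp (2 * c) * (Real.exp (-(a : ℝ) ^ 2) * Real.exp (-(2 * c))) := by ring
    _ < _ := h7
    _ = (c / (8 * a)) ^ a * (Real.exp ((a : ℝ) ^ 2) * Real.exp (-(a : ℝ) ^ 2)) *
        Real.exp (-(2 * c)) := by ring
    _ = _ := by rw [e3, mul_one]

/-- Propagation gets past step `a` with probability at least `D`, is lost before step `n / 2` with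
probability at most `T < D`, and by then avoids rejection only with vanishing probability. -/
theorem exists_eventually_le_unsatProb (hc : 0 < c) :
    ∃ δ > 0, ∀ᶠ n : ℕ in atTop, δ ≤ unsatProb n ⌊c * 2 ^ n⌋₊ := by
  obtain ⟨a, ha, hlt⟩ := exists_tsum_stopBound_lt hc
  set T := ∑' j, stopBound c (j + a)
  set D := (c / (8 * a)) ^ a * Real.exp (-(2 * c))
  refine ⟨(D - T) / 2, by linarith, ?_⟩
  filter_upwards [eventually_floor_bounds hc, eventually_ge_atTop (2 * a),
    (tendsto_avoidProb_half hc).eventually (ge_mem_nhds (show 0 < (D - T) / 2 by linarith))]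
    with n ⟨hn, hm, hm'⟩ h2a hA
  have h1 := reachProb_sub_avoidProb_le (m := ⌊c * 2 ^ n⌋₊) hn (Nat.div_le_self n 2)
  have h2 : D ≤ reachProb n ⌊c * 2 ^ n⌋₊ a := le_avg_reach hc.le hn hm hm' ha h2a
  have h3 : reachProb n ⌊c * 2 ^ n⌋₊ a - reachProb n ⌊c * 2 ^ n⌋₊ (n / 2) ≤ _ :=
    avg_reach_sub_le_sum hc.le hn hm hm' (by omega) (by omega)
  have h4 := sum_stopBound_le hc a (n / 2)
  linarith

/-- For a large fixed `a`, both quantities lie between `reachProb` at `n / 2` and at `a`, up to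
vanishing errors. These two values differ by at most a tail of `stopBound`. -/
theorem tendsto_reachProb_sub_unsatProb (hc : 0 < c) {i : ℕ → ℕ} (hi : Tendsto i atTop atTop)
    (hin : ∀ᶠ n in atTop, 2 * i n ≤ n) :
    Tendsto (fun n : ℕ => reachProb n ⌊c * 2 ^ n⌋₊ (i n) - unsatProb n ⌊c * 2 ^ n⌋₊)
      atTop (𝓝 0) := by
  rw [Metric.tendsto_nhds]
  intro ε hε
  have hε3 : 0 < ε / 4 := by positivity
  obtain ⟨a, ha⟩ := ((tendsto_sum_nat_add (stopBound c)).eventually (ge_mem_nhds hε3)).exists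
  have h1 : Tendsto (fun n : ℕ => c * ((2 : ℝ) ^ a / n)) atTop (𝓝 (c * 0)) :=
    (tendsto_const_div_atTop_nhds_zero_nat _).const_mul c
  rw [mul_zero] at h1
  filter_upwards [eventually_floor_bounds hc, eventually_ge_atTop (2 * a), hin,
    hi.eventually_ge_atTop a, h1.eventually (ge_mem_nhds hε3),
    (tendsto_avoidProb_half hc).eventually (ge_mem_nhds hε3)] with n ⟨hn, hm, hm'⟩ h2a h2i hai hA hB
  have g1 := reachProb_sub_avoidProb_le (m := ⌊c * 2 ^ n⌋₊) hn (Nat.div_le_self n 2)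
  have g2 := unsatProb_le (m := ⌊c * 2 ^ n⌋₊) hn (by omega : a ≤ n)
  have g3 : reachProb n ⌊c * 2 ^ n⌋₊ a - reachProb n ⌊c * 2 ^ n⌋₊ (n / 2) ≤ _ :=
    avg_reach_sub_le_sum hc.le hn hm hm' (by omega) (by omega)
  have g4 := sum_stopBound_le hc a (n / 2)
  have g5 := reachProb_antitone n ⌊c * 2 ^ n⌋₊ hai
  have g6 := reachProb_antitone n ⌊c * 2 ^ n⌋₊ (by omega : i n ≤ n / 2)
  have g7 := one_sub_avoidProb_le hn (by omega : a ≤ n) hm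
  rw [Real.dist_eq, sub_zero, abs_lt]
  constructor <;> linarith

theorem exp_neg_sub_exp_neg_le {u v : ℝ} (hu : 0 ≤ u) :
    Real.exp (-u) - Real.exp (-v) ≤ |v - u| := by
  rcases le_total u v with h | h
  · rw [abs_of_nonneg (sub_nonneg.2 h)]
    have h1 : Real.exp (-v) = Real.exp (-u) * Real.exp (-(v - u)) := by
      rw [← Real.exp_add]; ring_nf
    have h2 := Real.add_one_le_exp (-(v - u))
    have h3 : Real.exp (-u) ≤ 1 := Real.exp_le_one_iff.2 (by linarith)
    have h4 := Real.exp_pos (-u)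
    rw [h1]
    nlinarith
  · have : Real.exp (-u) ≤ Real.exp (-v) := Real.exp_le_exp.2 (by linarith)
    have := abs_nonneg (v - u)
    linarith

/-- Only boundedness of `2^i / n` is assumed, since it oscillates with the fractional part of `log₂
n`. The two exponential bounds are therefore compared with a moving target. -/
theorem tendsto_avoidProb_sub_exp (hc : 0 < c) {i : ℕ → ℕ} {K : ℝ}
    (hK : ∀ᶠ n : ℕ in atTop, (2 : ℝ) ^ i n / n ≤ K) :
    Tendsto (fun n : ℕ => avoidProb n ⌊c * 2 ^ n⌋₊ (i n) - Real.exp (-(c * (2 ^ i n / n))))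
      atTop (𝓝 0) := by
  set θ : ℕ → ℝ := fun n => (n * ⌊c * 2 ^ n⌋₊ : ℝ) / Fintype.card (HornClause n) with hθ
  have hθc : Tendsto θ atTop (𝓝 c) := tendsto_mul_div_card hc
  have hinv : Tendsto (fun n : ℕ => (n : ℝ)⁻¹) atTop (𝓝 0) := tendsto_inv_atTop_nhds_zero_nat
  have hpow : Tendsto (fun n : ℕ => K * ((2 : ℝ) ^ n)⁻¹) atTop (𝓝 (K * 0)) :=
    (tendsto_inv_atTop_zero.comp
      (tendsto_pow_atTop_atTop_of_one_lt (r := (2 : ℝ)) (by norm_num))).const_mul K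
  rw [mul_zero] at hpow
  have hB : Tendsto (fun n => |θ n - c| * K + θ n * (n : ℝ)⁻¹ +
      θ n * K * (2 * (K * ((2 : ℝ) ^ n)⁻¹))) atTop (𝓝 0) := by
    have h1 : Tendsto (fun n => |θ n - c|) atTop (𝓝 0) := by
      simpa using (hθc.sub_const c).abs
    have := ((h1.mul_const K).add (hθc.mul hinv)).add
      ((hθc.mul_const K).mul (hpow.const_mul 2))
    simpa using this
  refine squeeze_zero_norm' ?_ hB
  filter_upwards [eventually_ge_atTop 1, hK,
    hpow.eventually (ge_mem_nhds (by norm_num : (0 : ℝ) < 1 / 2))] with n hn hs hy2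
  have hn0 : (0 : ℝ) < n := by exact_mod_cast hn
  have hH := card_pos_real hn
  have hθ0 : 0 ≤ θ n := by positivity
  set s : ℝ := 2 ^ i n / n with hsdef
  have hs0 : 0 < s := by positivity
  have hK0 : 0 ≤ K := hs0.le.trans hs
  have hs1 : ((2 : ℝ) ^ i n - 1) / n = s - (n : ℝ)⁻¹ := by rw [sub_div, one_div]
  have hs2 : 0 ≤ s - (n : ℝ)⁻¹ := by
    rw [← hs1]
    exact div_nonneg (sub_nonneg.2 (one_le_pow₀ (by norm_num))) hn0.le
  set y : ℝ := (2 ^ i n - 1) / Fintype.card (HornClause n) with hydef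
  have hy0 : 0 ≤ y := avoidRatio_nonneg
  have hyK : y ≤ K * ((2 : ℝ) ^ n)⁻¹ := by
    refine (avoidRatio_le hn).trans ?_
    rw [← div_div, div_eq_mul_inv]
    gcongr
  have hA1 : avoidProb n ⌊c * 2 ^ n⌋₊ (i n) ≤ Real.exp (-(θ n * (s - (n : ℝ)⁻¹))) := by
    have h := Real.add_one_le_exp (-y)
    calc avoidProb n ⌊c * 2 ^ n⌋₊ (i n) ≤ Real.exp (-y) ^ ⌊c * 2 ^ n⌋₊ := by
          rw [avoidProb, ← hydef]
          gcongr
          · linarith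
          · linarith
      _ = _ := by
          rw [← Real.exp_nat_mul, ← hs1, hydef, hθ]
          congr 1
          field_simp
  have hA2 := exp_le_avoidProb (m := ⌊c * 2 ^ n⌋₊) (i := i n) hn (hyK.trans hy2)
  rw [hs1, ← hydef] at hA2
  change Real.exp (-(θ n * (s - (n : ℝ)⁻¹) * (1 + 2 * y))) ≤ _ at hA2
  have hninv : (0 : ℝ) ≤ (n : ℝ)⁻¹ := by positivity
  have d1 : |c * s - θ n * (s - (n : ℝ)⁻¹)| ≤ |θ n - c| * K + θ n * (n : ℝ)⁻¹ := by
    have e : c * s - θ n * (s - (n : ℝ)⁻¹) = (c - θ n) * s + θ n * (n : ℝ)⁻¹ := by ring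
    rw [e]
    refine (abs_add_le _ _).trans ?_
    rw [abs_mul, abs_sub_comm, abs_of_pos hs0, abs_of_nonneg (mul_nonneg hθ0 hninv)]
    gcongr
  have d3 : 0 ≤ θ n * (s - (n : ℝ)⁻¹) * (2 * y) := by positivity
  have d4 : θ n * (s - (n : ℝ)⁻¹) * (2 * y) ≤ θ n * K * (2 * (K * ((2 : ℝ) ^ n)⁻¹)) := by
    gcongr
    linarith
  have d2 : |θ n * (s - (n : ℝ)⁻¹) * (1 + 2 * y) - c * s| ≤
      |θ n - c| * K + θ n * (n : ℝ)⁻¹ + θ n * (s - (n : ℝ)⁻¹) * (2 * y) := by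
    have e : θ n * (s - (n : ℝ)⁻¹) * (1 + 2 * y) - c * s =
        -(c * s - θ n * (s - (n : ℝ)⁻¹)) + θ n * (s - (n : ℝ)⁻¹) * (2 * y) := by ring
    rw [e]
    refine (abs_add_le _ _).trans ?_
    rw [abs_neg, abs_of_nonneg d3]
    gcongr
  have f1 := exp_neg_sub_exp_neg_le (v := c * s) (mul_nonneg hθ0 hs2)
  have f2 := exp_neg_sub_exp_neg_le (u := c * s) (v := θ n * (s - (n : ℝ)⁻¹) * (1 + 2 * y))
    (by positivity)
  rw [Real.norm_eq_abs, abs_le]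
  constructor <;> linarith

theorem tendsto_sqrt_variance_bound {i : ℕ → ℕ} {K : ℝ}
    (hK : ∀ᶠ n : ℕ in atTop, (2 : ℝ) ^ i n / n ≤ K) :
    Tendsto (fun n : ℕ => √(c * ((2 ^ i n) ^ 2 / (n * (2 ^ n - 1))))) atTop (𝓝 0) := by
  have h0 : Tendsto (fun n : ℕ => K ^ 2 * (2 * ((n : ℝ) / 2 ^ n))) atTop (𝓝 0) := by
    simpa using (tendsto_natCast_div_two_pow.const_mul 2).const_mul (K ^ 2)
  have h1 : Tendsto (fun n : ℕ => ((2 : ℝ) ^ i n) ^ 2 / (n * (2 ^ n - 1))) atTop (𝓝 0) := by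
    refine tendsto_of_tendsto_of_tendsto_of_le_of_le' tendsto_const_nhds h0 ?_ ?_
    · filter_upwards [eventually_ge_atTop 1] with n hn
      have := two_pow_sub_one_pos hn
      positivity
    · filter_upwards [eventually_ge_atTop 1, hK] with n hn hs
      have hn0 : (0 : ℝ) < n := by exact_mod_cast hn
      have hp := two_pow_sub_one_pos hn
      have h2 : (2 : ℝ) ≤ 2 ^ n := le_self_pow₀ (by norm_num) (by omega)
      calc ((2 : ℝ) ^ i n) ^ 2 / (n * (2 ^ n - 1))
          = (2 ^ i n / n) ^ 2 * (n / (2 ^ n - 1)) := by field_simp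
        _ ≤ K ^ 2 * (n / (2 ^ n / 2)) := by
            gcongr
            linarith
        _ = _ := by field_simp
  simpa using (h1.const_mul c).sqrt

end

/-! ### The scale `log₂ n` and the two limit statements. -/

section

variable {c : ℝ}

theorem two_zpow_floor_logb_add {n : ℕ} (hn : 1 ≤ n) (k : ℤ) :
    (2 : ℝ) ^ (⌊Real.logb 2 n⌋ + k) / n = 2 ^ k / 2 ^ Int.fract (Real.logb 2 n) := by
  have hn0 : (0 : ℝ) < n := by exact_mod_cast hn
  have h : (2 : ℝ) ^ ⌊Real.logb 2 n⌋ * 2 ^ Int.fract (Real.logb 2 n) = n := by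
    rw [← Real.rpow_intCast, ← Real.rpow_add (by norm_num), Int.floor_add_fract,
      Real.rpow_logb (by norm_num) (by norm_num) hn0]
  have hf : (0 : ℝ) < 2 ^ Int.fract (Real.logb 2 n) := by positivity
  rw [zpow_add₀ (by norm_num), div_eq_div_iff hn0.ne' hf.ne', mul_right_comm, h, mul_comm]

/-- The index `⌊log₂ n⌋ + k`, truncated at `0`. -/
def logIndex (k : ℤ) (n : ℕ) : ℕ := (⌊Real.logb 2 n⌋ + k).toNat

theorem tendsto_floor_logb : Tendsto (fun n : ℕ => ⌊Real.logb 2 n⌋) atTop atTop :=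
  tendsto_floor_atTop.comp
    ((Real.tendsto_logb_atTop (by norm_num)).comp tendsto_natCast_atTop_atTop)

theorem eventually_logIndex (k : ℤ) :
    ∀ᶠ n : ℕ in atTop, (logIndex k n : ℤ) = ⌊Real.logb 2 n⌋ + k := by
  filter_upwards [tendsto_floor_logb.eventually_ge_atTop (-k)] with n hn
  rw [logIndex, Int.toNat_of_nonneg (by omega)]

theorem tendsto_logIndex (k : ℤ) : Tendsto (logIndex k) atTop atTop := by
  refine tendsto_atTop.2 fun b => ?_
  filter_upwards [tendsto_floor_logb.eventually_ge_atTop (b - k)] with n hn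
  rw [logIndex]
  omega

theorem eventually_two_pow_logIndex (k : ℤ) :
    ∀ᶠ n : ℕ in atTop, (2 : ℝ) ^ logIndex k n / n = 2 ^ k / 2 ^ Int.fract (Real.logb 2 n) := by
  filter_upwards [eventually_logIndex k, eventually_ge_atTop 1] with n h hn
  rw [← two_zpow_floor_logb_add hn, ← h, zpow_natCast]

theorem eventually_two_pow_logIndex_le (k : ℤ) :
    ∀ᶠ n : ℕ in atTop, (2 : ℝ) ^ logIndex k n / n ≤ 2 ^ k := by
  filter_upwards [eventually_two_pow_logIndex k] with n h
  rw [h]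
  exact div_le_self (by positivity) (Real.one_le_rpow (by norm_num) (Int.fract_nonneg _))

/-- Squaring the hypothesis gives `4^i ≤ K^2 * n^2`, which is eventually at most `2^n`. -/
theorem eventually_two_mul_le {i : ℕ → ℕ} {K : ℝ}
    (hK : ∀ᶠ n : ℕ in atTop, (2 : ℝ) ^ i n / n ≤ K) : ∀ᶠ n in atTop, 2 * i n ≤ n := by
  have h : Tendsto (fun n : ℕ => K ^ 2 * ((n : ℝ) ^ 2 / 2 ^ n)) atTop (𝓝 (K ^ 2 * 0)) :=
    (tendsto_pow_const_div_const_pow_of_one_lt 2 (r := (2 : ℝ)) (by norm_num)).const_mul _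
  rw [mul_zero] at h
  filter_upwards [hK, h.eventually (ge_mem_nhds one_pos), eventually_ge_atTop 1] with n h1 h2 hn
  have hn0 : (0 : ℝ) < n := by exact_mod_cast hn
  rw [← mul_div_assoc, div_le_one (by positivity)] at h2
  rw [div_le_iff₀ hn0] at h1
  have h3 : (2 : ℝ) ^ (2 * i n) ≤ 2 ^ n := by
    calc (2 : ℝ) ^ (2 * i n) = (2 ^ i n) ^ 2 := by rw [mul_comm, pow_mul]
      _ ≤ (K * n) ^ 2 := by gcongr
      _ ≤ _ := by rw [mul_pow]; exact h2
  exact (pow_le_pow_iff_right₀ (by norm_num)).1 h3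

theorem eventually_logIndex_succ (k : ℤ) :
    ∀ᶠ n : ℕ in atTop, logIndex k n + 1 = logIndex (k + 1) n := by
  filter_upwards [eventually_logIndex k, eventually_logIndex (k + 1)] with n h1 h2
  omega

theorem tendsto_rejectProb_div_sub (hc : 0 < c) (k : ℤ) :
    Tendsto (fun n : ℕ => rejectProb n ⌊c * 2 ^ n⌋₊ (logIndex k n) / unsatProb n ⌊c * 2 ^ n⌋₊ -
      (avoidProb n ⌊c * 2 ^ n⌋₊ (logIndex k n) -
        avoidProb n ⌊c * 2 ^ n⌋₊ (logIndex (k + 1) n))) atTop (𝓝 0) := by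
  obtain ⟨δ, hδ, hU⟩ := exists_eventually_le_unsatProb hc
  have hk := eventually_two_mul_le (eventually_two_pow_logIndex_le (k + 1))
  have hR := (tendsto_reachProb_sub_unsatProb hc (tendsto_logIndex (k + 1)) hk).abs
  have hV := (tendsto_sqrt_variance_bound (c := c) (eventually_two_pow_logIndex_le k)).add
    (tendsto_sqrt_variance_bound (c := c) (eventually_two_pow_logIndex_le (k + 1)))
  have hB := (hV.add hR).div_const δ
  simp only [abs_zero, add_zero, zero_div] at hB
  refine squeeze_zero_norm' ?_ hB
  filter_upwards [hU, hk, eventually_logIndex_succ k, eventually_floor_bounds hc]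
    with n hUn hkn hs ⟨hn, hm, _⟩
  have hi : logIndex k n < n := by omega
  have h1 := abs_rejectProb_sub_le hi hm
  have h2 := avoidProb_succ_le (m := ⌊c * 2 ^ n⌋₊) hn hi
  have h3 := avoidProb_nonneg (m := ⌊c * 2 ^ n⌋₊) hn hi
  have h4 := avoidProb_le_one (m := ⌊c * 2 ^ n⌋₊) hn hi.le
  rw [hs] at h1 h2
  rw [Nat.succ_eq_add_one, hs] at h3
  set Q := rejectProb n ⌊c * 2 ^ n⌋₊ (logIndex k n)
  set U := unsatProb n ⌊c * 2 ^ n⌋₊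
  set R := reachProb n ⌊c * 2 ^ n⌋₊ (logIndex (k + 1) n)
  set a := avoidProb n ⌊c * 2 ^ n⌋₊ (logIndex k n) -
    avoidProb n ⌊c * 2 ^ n⌋₊ (logIndex (k + 1) n) with ha
  have hU0 : 0 < U := hδ.trans_le hUn
  -- The first summand is the covariance error; the second is the cost of replacing the reach
  -- probability by the rejection probability.
  have e : Q / U - a = ((Q - R * a) + (R - U) * a) / U := by
    field_simp
    ring
  have ha0 : 0 ≤ a := by linarith
  have ha1 : a ≤ 1 := by linarith
  rw [Real.norm_eq_abs, e, abs_div, abs_of_pos hU0]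
  have h5 : |(Q - R * a) + (R - U) * a| ≤ |Q - R * a| + |R - U| := by
    refine (abs_add_le _ _).trans ?_
    rw [abs_mul, abs_of_nonneg ha0]
    gcongr
    exact mul_le_of_le_one_right (abs_nonneg _) ha1
  gcongr
  linarith

theorem tendsto_eta_sub (hc : 0 < c) (k : ℤ) :
    Tendsto (fun n : ℕ => eta c n k - (G (k - 1) (cSeq c n) - G k (cSeq c n))) atTop (𝓝 0) := by
  have h1 := tendsto_rejectProb_div_sub hc k
  have h2 := tendsto_avoidProb_sub_exp hc (eventually_two_pow_logIndex_le k)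
  have h3 := tendsto_avoidProb_sub_exp hc (eventually_two_pow_logIndex_le (k + 1))
  have h := h1.add (h2.sub h3)
  simp only [sub_zero, add_zero] at h
  refine h.congr' ?_
  filter_upwards [eventually_logIndex k, eventually_two_pow_logIndex k,
    eventually_two_pow_logIndex (k + 1), eventually_ge_atTop 1] with n g1 g2 g3 hn
  rw [eta, ← g1, iterProbUnsat_natCast hn, G_eq, G_eq, cSeq, sub_add_cancel, g2, g3]
  have e : ∀ z : ℝ, c / 2 ^ Int.fract (Real.logb 2 n) * z =
      c * (z / 2 ^ Int.fract (Real.logb 2 n)) := fun z => by ring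
  rw [e, e]
  ring

theorem two_pow_div_eq_rpow {n : ℕ} (hn : 1 ≤ n) (i : ℕ) :
    (2 : ℝ) ^ i / n = 2 ^ ((i : ℝ) - Real.logb 2 n) := by
  have hn0 : (0 : ℝ) < n := by exact_mod_cast hn
  rw [Real.rpow_sub (by norm_num), Real.rpow_natCast,
    Real.rpow_logb (by norm_num) (by norm_num) hn0]

/-- Above `log₂ n` survival for `i` steps is unlikely; below it, rejection within `i + 1` steps is
unlikely. Adding the two bounds covers both sides, and the factor 2 comes from the index `i + 1`. -/
theorem rejectProb_le {n : ℕ} (hc : 0 < c) (hn : 1 ≤ n)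
    (hm : (⌊c * 2 ^ n⌋₊ : ℝ) ≤ c * 2 ^ n)
    (hm' : c * 2 ^ n / 2 ≤ (⌊c * 2 ^ n⌋₊ : ℝ) - n) (i : ℕ) :
    rejectProb n ⌊c * 2 ^ n⌋₊ i ≤
      Real.exp (-(c / 4 * ((2 : ℝ) ^ |(i : ℝ) - Real.logb 2 n| - 1))) +
        2 * c * ((2 : ℝ) ^ |(i : ℝ) - Real.logb 2 n|)⁻¹ := by
  have hr : (0 : ℝ) < 2 ^ |(i : ℝ) - Real.logb 2 n| := by positivity
  have he := Real.exp_pos (-(c / 4 * ((2 : ℝ) ^ |(i : ℝ) - Real.logb 2 n| - 1)))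
  have hinv : 0 ≤ 2 * c * ((2 : ℝ) ^ |(i : ℝ) - Real.logb 2 n|)⁻¹ := by positivity
  have hn0 : (0 : ℝ) < n := by exact_mod_cast hn
  have hn1 : (1 : ℝ) ≤ n := by exact_mod_cast hn
  rcases le_or_gt n i with hi | hi
  · rw [rejectProb_eq_zero hi]
    linarith
  · rcases le_total 0 ((i : ℝ) - Real.logb 2 n) with h | h
    · have h1 := (rejectProb_le_avoidProb (m := ⌊c * 2 ^ n⌋₊) hi).trans
        (avoidProb_le_exp' hn hi.le hc.le (by linarith))
      have h2 : Real.exp (-(c / 4 * ((2 ^ i - 1) / n))) ≤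
          Real.exp (-(c / 4 * ((2 : ℝ) ^ |(i : ℝ) - Real.logb 2 n| - 1))) := by
        rw [abs_of_nonneg h, ← two_pow_div_eq_rpow hn]
        refine Real.exp_le_exp.2 (neg_le_neg ?_)
        gcongr
        rw [sub_div]
        have : 1 / (n : ℝ) ≤ 1 := (div_le_one hn0).2 hn1
        linarith
      linarith
    · have h1 := (rejectProb_le_one_sub_avoidProb (m := ⌊c * 2 ^ n⌋₊) hi).trans
        (one_sub_avoidProb_le hn hi hm)
      have h2 : c * ((2 : ℝ) ^ (i + 1) / n) =
          2 * c * ((2 : ℝ) ^ |(i : ℝ) - Real.logb 2 n|)⁻¹ := by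
        rw [abs_of_nonpos h, ← Real.rpow_neg (by norm_num), neg_neg, ← two_pow_div_eq_rpow hn]
        ring
      linarith

theorem tendsto_iterProbUnsat (hc : 0 < c) {k : ℕ → ℤ}
    (hk : Tendsto (fun n : ℕ => |(k n : ℝ) - Real.logb 2 n|) atTop atTop) :
    Tendsto (fun n : ℕ => iterProbUnsat c n (k n)) atTop (𝓝 0) := by
  obtain ⟨δ, hδ, hU⟩ := exists_eventually_le_unsatProb hc
  have h2 : Tendsto (fun n : ℕ => (2 : ℝ) ^ |(k n : ℝ) - Real.logb 2 n|) atTop atTop :=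
    (tendsto_rpow_atTop_of_base_gt_one 2 (by norm_num)).comp hk
  have h3 : Tendsto (fun n : ℕ =>
      Real.exp (-(c / 4 * ((2 : ℝ) ^ |(k n : ℝ) - Real.logb 2 n| - 1)))) atTop (𝓝 0) :=
    Real.tendsto_exp_neg_atTop_nhds_zero.comp
      ((tendsto_atTop_add_const_right _ (-1) h2).const_mul_atTop (by positivity))
  have h4 := (h3.add ((tendsto_inv_atTop_zero.comp h2).const_mul (2 * c))).div_const δ
  simp only [mul_zero, add_zero, zero_div] at h4
  refine squeeze_zero' ?_ ?_ h4
  · filter_upwards [hU, eventually_ge_atTop 1] with n hUn hn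
    rcases lt_or_ge (k n) 0 with h | h
    · rw [iterProbUnsat_of_neg c n h]
    · obtain ⟨i, hi⟩ := Int.eq_ofNat_of_zero_le h
      rw [hi, iterProbUnsat_natCast hn]
      exact div_nonneg (rejectProb_nonneg _ _ _) (hδ.le.trans hUn)
  · filter_upwards [hU, eventually_floor_bounds hc] with n hUn ⟨hn, hm, hm'⟩
    rcases lt_or_ge (k n) 0 with h | h
    · rw [iterProbUnsat_of_neg c n h]
      simp only [Function.comp_apply]
      positivity
    · obtain ⟨i, hi⟩ := Int.eq_ofNat_of_zero_le h
      have h5 := rejectProb_le hc hn hm hm' i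
      have e : (i : ℝ) = k n := by rw [hi, Int.cast_natCast]
      rw [e] at h5
      have h7 : iterProbUnsat c n (k n) =
          rejectProb n ⌊c * 2 ^ n⌋₊ i / unsatProb n ⌊c * 2 ^ n⌋₊ := by
        rw [hi, iterProbUnsat_natCast hn]
      rw [h7]
      simp only [Function.comp_apply]
      have h6 := rejectProb_nonneg n ⌊c * 2 ^ n⌋₊ i
      calc _ ≤ rejectProb n ⌊c * 2 ^ n⌋₊ i / δ := by gcongr
        _ ≤ _ := by gcongr

end

end RandomHorn

end

theorem theorem2p3 (c : ℝ) (hc : 0 < c) :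
    (∀ k : ℕ → ℤ, Tendsto (fun n : ℕ => |(k n : ℝ) - Real.logb 2 n|) atTop atTop →
      Tendsto (fun n : ℕ => RandomHorn.iterProbUnsat c n (k n)) atTop (𝓝 0)) ∧
    (∀ k : ℤ, (fun n : ℕ => RandomHorn.eta c n k -
        (RandomHorn.G (k - 1) (RandomHorn.cSeq c n) - RandomHorn.G k (RandomHorn.cSeq c n)))
      =o[atTop] (fun _ : ℕ => (1 : ℝ))) :=
  ⟨fun _ hk => RandomHorn.tendsto_iterProbUnsat hc hk,
    fun k => (isLittleO_one_iff ℝ).2 (RandomHorn.tendsto_eta_sub hc k)⟩
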